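/- Let $S$ be a nonempty complete separable metric space, $M_1=M_1(S)$ the space of Borel probability measures on $S$ (with the Borel $\sigma$-algebra of the Prohorov metric, i.e. the one generated by the maps $\nu\mapsto\nu(B)$), and for a nonzero finite Borel measure $\alpha$ on $S$ let $\mathcal D(\alpha)$ be the law on $M_1$ of a Dirichlet process with parameter $\alpha$, i.e. the unique Borel probability measure on $M_1$ such that, for $\lambda\sim\mathcal D(\alpha)$ and every finite measurable partition $B_0,\dots,B_d$ of $S$, the vector $(\lambda(B_0),\dots,\lambda(B_d))$ has the Dirichlet distribution $\mathrm{Dir}(\alpha(B_0),\dots,\alpha(B_d))$ (coordinates with parameter $0$ being $0$). Write $\mathcal L(X\mid Y)$ for the regular conditional distribution of $X$ given $Y$ and $\mathcal L(X\mid Y;\cdot)$ for its values. All random variables are defined on one probability space. Let $\alpha$ be a random measure on $S$ with $\alpha(S)\in(0,\infty)$ a.s., and put $\kappa=\alpha(S)$, $\rho=\alpha/\alpha(S)$, random variables with values in $(0,\infty)$ and $M_1$. Let $\lambda$ be a random probability measure on $S$ with $\lambda\mid\alpha\sim\mathcal D(\alpha)$ (a mixture of Dirichlet processes), and let $\eta=\{\eta_i\}_{i\ge1}$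 be a sequence of $S$-valued random variables with $\eta\mid\lambda,\alpha\sim\lambda^\infty$. Let $n\ge 0$, $\boldsymbol\eta_n=(\eta_1,\dots,\eta_n)$, and let $Y$ be a random variable with values in a measurable space $T$ such that $Y$ and $(\lambda,\alpha)$ are conditionally independent given $\boldsymbol\eta_n$. Then, almost surely, $$\mathcal L(\lambda\mid Y)=\int_{(0,\infty)\times M_1\times S^n}\mathcal D\Big(t\nu+\sum_{i=1}^n\delta_{x_i}\Big)\,\mathcal L(\kappa,\rho,\boldsymbol\eta_n\mid Y;dt\,d\nu\,dx).$$ In particular, let $\alpha$ be a nonrandom nonzero finite Borel measure on $S$, and let $\lambda\sim\mathcal D(\alpha)$, $\eta\mid\lambda\sim\lambda^\infty$, with $Y$ and $\lambda$ conditionally independent given $\boldsymbol\eta_n$. Then, almost surely, $$\mathcal L(\lambda\mid Y)=\int_{S^n}\mathcal D\Big(\alpha+\sum_{i=1}^n\delta_{x_i}\Big)\,\mathcal L(\boldsymbol\eta_n\mid Y;dx).$$ -/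

import Mathlib

open MeasureTheory ProbabilityTheory Set
open scoped ENNReal NNReal

/-- A measurable space that embeds measurably in a standard Borel space is standard Borel. -/
theorem standardBorelSpace_of_measurableEmbedding {E F : Type*} [MeasurableSpace E]
    [MeasurableSpace F] [StandardBorelSpace F] {f : E → F} (hf : MeasurableEmbedding f) :
    StandardBorelSpace E := by
  have hr : StandardBorelSpace (range f) := hf.measurableSet_range.standardBorel
  let e : E ≃ᵐ range f := hf.equivRange
  obtain ⟨τ, hτb, hτp⟩ := hr.polish
  let : TopologicalSpace E := TopologicalSpace.induced e inferInstance
  have hemb : Topology.IsClosedEmbedding e :=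
    { eq_induced := rfl
      injective := e.injective
      isClosed_range := by rw [e.surjective.range_eq]; exact isClosed_univ }
  have hp : PolishSpace E := hemb.polishSpace
  have hb : BorelSpace E := by
    refine ⟨?_⟩
    have h := congrArg (MeasurableSpace.comap e) hτb.measurable_eq
    rw [e.measurableEmbedding.comap_eq] at h
    exact h.trans borel_comap.symm
  infer_instance

/-- Evaluations at measurable sets are Borel measurable for the weak topology. -/
theorem measurable_eval_of_borel {E : Type*} [PseudoMetricSpace E] [MeasurableSpace E]
    [BorelSpace E] :
    Measurable[borel (ProbabilityMeasure E)]
      (fun μ : ProbabilityMeasure E => (μ : Measure E)) := by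
  let : MeasurableSpace (ProbabilityMeasure E) := borel _
  have : BorelSpace (ProbabilityMeasure E) := ⟨rfl⟩
  refine Measurable.measure_of_isPiSystem_of_isProbabilityMeasure
    (S := {s : Set E | IsClosed s}) ?_ isPiSystem_isClosed ?_
  · rw [← borel_eq_generateFrom_isClosed]; exact BorelSpace.measurable_eq
  · intro F hF
    have hpos : ∀ n : ℕ, (0 : ℝ) < 1 / ((n : ℝ) + 1) := fun n => by positivity
    refine measurable_of_tendsto_metrizable
      (f := fun (n : ℕ) (μ : ProbabilityMeasure E) =>
        ∫⁻ x, (thickenedIndicator (hpos n) F x : ℝ≥0∞) ∂(μ : Measure E)) ?_ ?_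
    · intro n
      have h := (ProbabilityMeasure.continuous_testAgainstNN_eval
        (thickenedIndicator (hpos n) F)).measurable.coe_nnreal_ennreal
      convert h using 2 with μ
      exact (FiniteMeasure.testAgainstNN_coe_eq (f := thickenedIndicator (hpos n) F)
        (μ := μ.toFiniteMeasure)).symm
    · rw [tendsto_pi_nhds]
      intro μ
      exact tendsto_lintegral_thickenedIndicator_of_isClosed (μ : Measure E) hF hpos
        tendsto_one_div_add_atTop_nhds_zero_nat

/-- A σ-algebra contained in the Borel σ-algebra of a Polish space, on which some injection into
a countably separated space is measurable, is standard Borel. -/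
theorem standardBorelSpace_of_le_borel (X : Type*) [TopologicalSpace X] [PolishSpace X]
    (mG : MeasurableSpace X) (hle : mG ≤ borel X) {Z : Type*} [mZ : MeasurableSpace Z]
    [MeasurableSpace.CountablySeparated Z] (F : X → Z) (hFm : Measurable[mG] F)
    (hFi : Function.Injective F) : StandardBorelSpace X := by
  have hge : borel X ≤ mG := by
    have hemb : @MeasurableEmbedding X Z (borel X) _ F := by
      let mB : MeasurableSpace X := borel X
      have : @BorelSpace X _ mB := ⟨rfl⟩
      have hstd : @StandardBorelSpace X mB := @standardBorel_of_polish X mB _ this _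
      have hFb : @Measurable X Z mB mZ F := fun s hs => hle _ (hFm hs)
      exact hFb.measurableEmbedding hFi
    rw [← @MeasurableEmbedding.comap_eq _ _ (borel X) _ F hemb]
    exact hFm.comap_le
  have : @BorelSpace X _ mG := ⟨le_antisymm hle hge⟩
  infer_instance

/-- Probability measures on the unit interval form a standard Borel space. -/
theorem standardBorelSpace_probabilityMeasure_unitInterval :
    StandardBorelSpace (ProbabilityMeasure unitInterval) := by
  let X := ProbabilityMeasure unitInterval
  let mG : MeasurableSpace X := inferInstance
  have hle : mG ≤ borel X := by
    have h := measurable_eval_of_borel (E := unitInterval)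
    intro s hs
    obtain ⟨t, ht, rfl⟩ := hs
    exact h ht
  let F : X → (ℚ → ℝ≥0∞) := fun μ q =>
    (μ : Measure unitInterval) (Subtype.val ⁻¹' (Iic (q : ℝ)))
  have hFm : Measurable[mG] F := by
    refine measurable_pi_lambda _ fun q => ?_
    exact (Measure.measurable_coe (measurable_subtype_coe measurableSet_Iic)).comp
      measurable_subtype_coe
  have hFi : Function.Injective F := by
    intro μ ν h
    have hmap : (μ : Measure unitInterval).map Subtype.val
        = (ν : Measure unitInterval).map Subtype.val := by
      have : IsFiniteMeasure ((μ : Measure unitInterval).map Subtype.val) := inferInstance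
      refine ext_of_generate_finite _
        (BorelSpace.measurable_eq.trans Real.borel_eq_generateFrom_Iic_rat)
        Real.isPiSystem_Iic_rat ?_ ?_
      · intro s hs
        simp only [mem_iUnion, mem_singleton_iff] at hs
        obtain ⟨q, rfl⟩ := hs
        rw [Measure.map_apply measurable_subtype_coe measurableSet_Iic,
          Measure.map_apply measurable_subtype_coe measurableSet_Iic]
        exact congrFun h q
      · rw [Measure.map_apply measurable_subtype_coe MeasurableSet.univ,
          Measure.map_apply measurable_subtype_coe MeasurableSet.univ]
        simp
    apply Subtype.ext
    have hI : MeasurableEmbedding (Subtype.val : unitInterval → ℝ) :=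
      MeasurableEmbedding.subtype_coe measurableSet_Icc
    have := congrArg (Measure.comap (Subtype.val : unitInterval → ℝ)) hmap
    rwa [hI.comap_map, hI.comap_map] at this
  have hPol : PolishSpace X := by
    let : MetricSpace X := TopologicalSpace.metrizableSpaceMetric X
    infer_instance
  exact standardBorelSpace_of_le_borel X mG hle F hFm hFi

/-- The space `M₁(S)` of probability measures on a standard Borel space `S`, with the σ-algebra
generated by the evaluations `ν ↦ ν B`, is standard Borel. (When `S` is a separable metric space,
this σ-algebra is the Borel σ-algebra of the Prohorov metric.) -/
instance instStandardBorelSpaceProbabilityMeasure {S : Type*} [MeasurableSpace S]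
    [StandardBorelSpace S] : StandardBorelSpace (ProbabilityMeasure S) := by
  have := standardBorelSpace_probabilityMeasure_unitInterval
  have hg := measurableEmbedding_sigmoid_comp_embeddingReal S
  set g : S → unitInterval := unitInterval.sigmoid ∘ embeddingReal S with hgdef
  let G : ProbabilityMeasure S → ProbabilityMeasure unitInterval :=
    fun μ => μ.map hg.measurable.aemeasurable
  have hGm : Measurable G := by
    refine Measurable.subtype_mk ?_
    exact (Measure.measurable_map g hg.measurable).comp measurable_subtype_coe
  have hGi : Function.Injective G := by
    intro μ ν h
    have h' : (μ : Measure S).map g = (ν : Measure S).map g := congrArg Subtype.val h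
    apply Subtype.ext
    have := congrArg (Measure.comap g) h'
    rwa [hg.comap_map, hg.comap_map] at this
  have hGr : range G = {ν : ProbabilityMeasure unitInterval | (ν : Measure unitInterval) (range g) = 1} := by
    ext ν
    constructor
    · rintro ⟨μ, rfl⟩
      change (μ : Measure S).map g (range g) = 1
      rw [Measure.map_apply hg.measurable hg.measurableSet_range]
      simp
    · intro hν
      have hν' : (ν : Measure unitInterval) (range g)ᶜ = 0 := by
        rw [prob_compl_eq_zero_iff hg.measurableSet_range]; exact hν
      have hmap : ((ν : Measure unitInterval).comap g).map g = ν := by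
        rw [hg.map_comap]
        exact Measure.restrict_eq_self_of_ae_mem hν'
      have hp : IsProbabilityMeasure ((ν : Measure unitInterval).comap g) := by
        refine ⟨?_⟩
        rw [hg.comap_apply, image_univ]; exact hν
      exact ⟨⟨_, hp⟩, Subtype.ext hmap⟩
  refine standardBorelSpace_of_measurableEmbedding (f := G)
    (MeasurableEmbedding.iff_comap_eq.2 ⟨hGi, le_antisymm hGm.comap_le ?_, ?_⟩)
  · let m' : MeasurableSpace (ProbabilityMeasure S) :=
      MeasurableSpace.comap G inferInstance
    have hGm' : Measurable[m'] G := comap_measurable G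
    have key : Measurable[m'] (fun μ : ProbabilityMeasure S => (μ : Measure S)) := by
      refine @Measure.measurable_of_measurable_coe _ _ _ m' _ fun B hB => ?_
      have h := ((Measure.measurable_coe (hg.measurableSet_image' hB)).comp
        (measurable_subtype_coe (p := fun ν : Measure unitInterval =>
          IsProbabilityMeasure ν))).comp hGm'
      convert h using 2 with μ
      change _ = (μ : Measure S).map g (g '' B)
      rw [hg.map_apply, hg.injective.preimage_image]
    exact key.comap_le
  · rw [hGr]
    exact ((Measure.measurable_coe hg.measurableSet_range).comp measurable_subtype_coe)
      (measurableSet_singleton 1)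

instance instNonemptyProbabilityMeasure {S : Type*} [MeasurableSpace S] [Nonempty S] :
    Nonempty (ProbabilityMeasure S) :=
  ⟨⟨Measure.dirac (Classical.arbitrary S), inferInstance⟩⟩

instance instStandardBorelSpaceIoiZero : StandardBorelSpace (Ioi (0 : ℝ)) := measurableSet_Ioi.standardBorel

noncomputable section

/-- The Gamma distribution with shape `a ≥ 0` and rate `1`; for `a = 0` it is the point mass
at `0`. -/
def gammaLaw (a : ℝ≥0) : Measure ℝ :=
  if a = 0 then Measure.dirac 0 else gammaMeasure (a : ℝ) 1

/-- The Dirichlet distribution `Dir(a₀, …, a_d)`, for `a₀, …, a_d ≥ 0` not all zero, on the simplex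
`Δ^d ⊆ ℝ^(d+1)`: the law of `(Z₀ / Z, …, Z_d / Z)`, where `Z₀, …, Z_d` are independent,
`Z_i ~ Gamma(a_i, 1)`, and `Z = Z₀ + ⋯ + Z_d`. -/
def dirichletDistribution {d : ℕ} (a : Fin (d + 1) → ℝ≥0) : Measure (Fin (d + 1) → ℝ) :=
  (Measure.pi fun i => gammaLaw (a i)).map fun z i => z i / ∑ j, z j

/-- `Q` is the law of a Dirichlet process on `S` with parameter `α`: if `λ ~ Q` then
`(λ(B₀), …, λ(B_d)) ~ Dir(α(B₀), …, α(B_d))` for every measurable partition `B₀, …, B_d` of `S`.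
No such `Q` exists if `α` is zero or infinite. -/
structure IsDirichletProcessLaw {S : Type*} [MeasurableSpace S] (α : Measure S)
    (Q : Measure (ProbabilityMeasure S)) : Prop where
  isProbabilityMeasure : IsProbabilityMeasure Q
  map_eval_eq : ∀ (d : ℕ) (B : Fin (d + 1) → Set S), (∀ i, MeasurableSet (B i)) →
    Pairwise (fun i j => Disjoint (B i) (B j)) → ⋃ i, B i = univ →
    Q.map (fun (ν : ProbabilityMeasure S) i => (ν : Measure S).real (B i)) =
      dirichletDistribution fun i => (α (B i)).toNNReal

open Classical in
/-- `D(α)`, the law on `M₁(S)` of a Dirichlet process on `S` with parameter `α`. (It exists and is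
unique for every nonzero finite Borel measure `α` on a Polish space; the value `0` stands for
"undefined".) -/
def dirichletProcess {S : Type*} [MeasurableSpace S] (α : Measure S) :
    Measure (ProbabilityMeasure S) :=
  if h : ∃ Q, IsDirichletProcessLaw α Q then h.choose else 0

/-- `X` and `Y` are conditionally independent given `Z`:
`P(X ∈ A, Y ∈ B | Z) = P(X ∈ A | Z) P(Y ∈ B | Z)` a.s. for all measurable `A`, `B`. -/
def CondIndepGiven {Ω E F G : Type*} [MeasurableSpace Ω] [MeasurableSpace E] [MeasurableSpace F]
    [mG : MeasurableSpace G] (X : Ω → E) (Y : Ω → F) (Z : Ω → G) (P : Measure Ω) : Prop :=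
  ∀ (A : Set E) (B : Set F), MeasurableSet A → MeasurableSet B →
    P⟦X ⁻¹' A ∩ Y ⁻¹' B | mG.comap Z⟧ =ᵐ[P] P⟦X ⁻¹' A | mG.comap Z⟧ * P⟦Y ⁻¹' B | mG.comap Z⟧

end

/-! A Dirichlet process is characterised by its mixed moments: `E ∏ λ(A_i)` is the probability
`urnProb` that successive draws from a Pólya urn with initial composition `α` fall into `A_1, A_2,
…`, where each draw `x` has law `α / α(S)` and replaces `α` by `α + δ_x`. One direction
(`IsDirichletProcessLaw.lintegral_list_prod`) reduces to a finite partition, where it says that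
size-biasing a Dirichlet vector by a coordinate raises that parameter by one
(`lintegral_dirichletDistribution_mul`). The converse
(`isDirichletProcessLaw_of_lintegral_list_prod`) holds because moments determine laws on a cube.

The posterior formula is then the restart property of the urn (`urnProb_ofFn_append`). Given `α`,
conditionally iid sampling turns `E[∏ λ(A_j); X ∈ ∏ B_i]` into the moment of `λ` for the
concatenated list `B, A`. This is the chance that the urn first draws from the `B_i` and then, from
composition `α + ∑ δ_{X_i}`, from the `A_j`. So the conditional moments of `λ` given `(α, X)` are
those of `D(α + ∑ δ_{X_i})` (`condDistrib_prod_eq_dirichletProcess`).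

For an observation `Y`, conditional independence replaces the event `Y ∈ D` by a weight `w(X)`.
Under such a weight `λ` may be averaged given `(α, X)`, which produces the mixture over the law of
`(α, X)` given `Y` (`condDistrib_eq_bind_dirichletProcess`). Existence of Dirichlet processes is
never constructed: for the priors it follows from the hypotheses, and for the posteriors the
conditional laws are themselves witnesses. -/

/-! ### Gamma laws: size-biasing and exponential tilting. -/

theorem gammaLaw_zero : gammaLaw 0 = Measure.dirac 0 := if_pos rfl

theorem gammaLaw_of_pos {a : ℝ≥0} (ha : a ≠ 0) : gammaLaw a = gammaMeasure (a : ℝ) 1 := if_neg ha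

instance isProbabilityMeasure_gammaLaw (a : ℝ≥0) : IsProbabilityMeasure (gammaLaw a) := by
  by_cases ha : a = 0
  · rw [ha, gammaLaw_zero]; infer_instance
  · rw [gammaLaw_of_pos ha]
    exact isProbabilityMeasure_gammaMeasure (by positivity) one_pos

theorem ae_nonneg_gammaLaw (a : ℝ≥0) : ∀ᵐ x ∂(gammaLaw a), 0 ≤ x := by
  by_cases ha : a = 0
  · rw [ha, gammaLaw_zero, ae_dirac_iff measurableSet_Ici]
  · rw [gammaLaw_of_pos ha, gammaMeasure, ae_withDensity_iff (by unfold gammaPDF; fun_prop)]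
    refine Filter.Eventually.of_forall fun x hx => ?_
    by_contra h
    exact hx (gammaPDF_of_neg (not_le.1 h))

/-- Size-biasing a Gamma distribution increases its shape by one. -/
theorem gammaLaw_withDensity_ofReal (a : ℝ≥0) :
    (gammaLaw a).withDensity ENNReal.ofReal = (a : ℝ≥0∞) • gammaLaw (a + 1) := by
  by_cases ha : a = 0
  · rw [ha, gammaLaw_zero, dirac_withDensity' ENNReal.measurable_ofReal]
    simp
  have hp : (0 : ℝ) < a := by positivity
  rw [gammaLaw_of_pos ha, gammaLaw_of_pos (by positivity), gammaMeasure, gammaMeasure,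
    ← withDensity_mul _ (by unfold gammaPDF; fun_prop) ENNReal.measurable_ofReal,
    ← withDensity_smul _ (by unfold gammaPDF; fun_prop)]
  congr 1
  ext x
  simp only [Pi.mul_apply, Pi.smul_apply, smul_eq_mul, gammaPDF_eq]
  split_ifs with hx
  · rw [← ENNReal.ofReal_mul' hx, ← ENNReal.ofReal_coe_nnreal, ← ENNReal.ofReal_mul (NNReal.coe_nonneg a)]
    congr 1
    push_cast
    rw [Real.Gamma_add_one hp.ne', add_sub_cancel_right]
    have hG := (Real.Gamma_pos_of_pos hp).ne'
    have : x ^ (a : ℝ) = x ^ ((a : ℝ) - 1) * x := by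
      rcases hx.eq_or_lt with rfl | hx
      · simp [hp.ne']
      · rw [← Real.rpow_add_one hx.ne', sub_add_cancel]
    rw [this]
    simp only [Real.one_rpow]
    field_simp
  · simp

/-- Exponential tilting of a Gamma distribution is scaling. -/
theorem gammaLaw_withDensity_exp (a : ℝ≥0) {t : ℝ} (ht : t < 1) :
    (gammaLaw a).withDensity (fun x => ENNReal.ofReal (Real.exp (t * x))) =
      ENNReal.ofReal ((1 - t) ^ (-(a : ℝ))) • (gammaLaw a).map fun x => (1 - t)⁻¹ * x := by
  have hc : 0 < 1 - t := by linarith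
  by_cases ha : a = 0
  · rw [ha, gammaLaw_zero, dirac_withDensity' (by fun_prop), Measure.map_dirac' (by fun_prop)]
    simp
  have hp : (0 : ℝ) < a := by positivity
  have hm : Measurable (gammaPDF (a : ℝ) 1) := by unfold gammaPDF; fun_prop
  rw [gammaLaw_of_pos ha, gammaMeasure, ← withDensity_mul _ hm (by fun_prop)]
  ext s hs
  rw [withDensity_apply _ hs, Measure.smul_apply, Measure.map_apply (by fun_prop) hs,
    withDensity_apply _ (by exact hs.preimage (by fun_prop)), smul_eq_mul,
    ← lintegral_indicator hs, ← lintegral_indicator (by exact hs.preimage (by fun_prop))]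
  -- Change of variables `x ↦ (1 - t) * x`: Lebesgue measure is `|1 - t|` times its own image.
  conv_rhs => rw [← Real.smul_map_volume_mul_left hc.ne']
  rw [lintegral_smul_measure, lintegral_map
    (hm.indicator (by exact hs.preimage (by fun_prop))) (by fun_prop), smul_eq_mul, ← mul_assoc,
    ← ENNReal.ofReal_mul (by positivity), ← lintegral_const_mul' _ _ ENNReal.ofReal_ne_top]
  refine lintegral_congr fun x => ?_
  have hmem : (1 - t) * x ∈ (fun x => (1 - t)⁻¹ * x) ⁻¹' s ↔ x ∈ s := by
    simp [inv_mul_cancel_left₀ hc.ne']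
  by_cases hxs : x ∈ s
  · rw [indicator_of_mem hxs, indicator_of_mem (hmem.2 hxs)]
    simp only [Pi.mul_apply, gammaPDF_eq, mul_nonneg_iff_of_pos_left hc]
    split_ifs with hx
    · rw [← ENNReal.ofReal_mul' (by positivity), ← ENNReal.ofReal_mul (by positivity)]
      congr 1
      rw [Real.mul_rpow hc.le hx, abs_of_pos hc, Real.rpow_sub_one hc.ne', Real.rpow_neg hc.le,
        mul_assoc, ← Real.exp_add]
      have : (1 - t) ^ (a : ℝ) ≠ 0 := by positivity
      field_simp
      ring_nf
    · simp
  · rw [indicator_of_notMem hxs, indicator_of_notMem (hmem.not.2 hxs), mul_zero]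

/-! ### Products of independent Gamma laws. -/

section Pi

variable {ι : Type*} [Fintype ι]

theorem lintegral_pi_prod_eq_prod {X : ι → Type*} [∀ i, MeasurableSpace (X i)]
    (μ : ∀ i, Measure (X i)) [∀ i, IsProbabilityMeasure (μ i)] {f : ∀ i, X i → ℝ≥0∞}
    (hf : ∀ i, Measurable (f i)) :
    ∫⁻ x, ∏ i, f i (x i) ∂(Measure.pi μ) = ∏ i, ∫⁻ x, f i x ∂(μ i) := by
  have h := lintegral_prod_eq_prod_lintegral_of_indepFun Finset.univ
    (fun i (x : ∀ i, X i) => f i (x i)) (iIndepFun_pi (μ := μ) (X := f) fun i => (hf i).aemeasurable)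
    fun i => (hf i).comp (measurable_pi_apply i)
  rw [h]
  refine Finset.prod_congr rfl fun i _ => ?_
  exact (measurePreserving_eval μ i).lintegral_comp (hf i)

/-- Both sides agree on boxes by independence. The constants lie in `ℝ≥0` so that the scaled factors
stay σ-finite and the product measure is determined by boxes. -/
theorem pi_withDensity_prod {X : ι → Type*} [∀ i, MeasurableSpace (X i)]
    (μ ν : ∀ i, Measure (X i)) [∀ i, IsProbabilityMeasure (μ i)] [∀ i, IsProbabilityMeasure (ν i)]
    {f : ∀ i, X i → ℝ≥0∞}
    (hf : ∀ i, Measurable (f i)) (c : ι → ℝ≥0) (h : ∀ i, (μ i).withDensity (f i) = (c i : ℝ≥0∞) • ν i) :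
    (Measure.pi μ).withDensity (fun x => ∏ i, f i (x i)) = ((∏ i, c i : ℝ≥0) : ℝ≥0∞) • Measure.pi ν := by
  have hσ : ∀ i, SigmaFinite ((c i) • ν i) := fun i => inferInstance
  have hpi : Measure.pi (fun i => (c i) • ν i) = ((∏ i, c i : ℝ≥0) : ℝ≥0∞) • Measure.pi ν := by
    refine Measure.pi_eq fun s hs => ?_
    rw [Measure.smul_apply, Measure.pi_pi, smul_eq_mul, ENNReal.ofNNReal_finsetProd,
      ← Finset.prod_mul_distrib]
    rfl
  rw [← hpi]
  refine (Measure.pi_eq fun s hs => ?_).symm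
  rw [withDensity_apply _ (MeasurableSet.univ_pi hs), ← lintegral_indicator (MeasurableSet.univ_pi hs)]
  have : ∀ x : ∀ i, X i, (univ.pi s).indicator (fun x => ∏ i, f i (x i)) x
      = ∏ i, (s i).indicator (f i) (x i) := by
    intro x
    by_cases hx : x ∈ univ.pi s
    · rw [indicator_of_mem hx]
      exact Finset.prod_congr rfl fun i _ => (indicator_of_mem (hx i trivial) _).symm
    · rw [indicator_of_notMem hx]
      simp only [mem_pi, mem_univ, true_implies, not_forall] at hx
      obtain ⟨i, hi⟩ := hx
      exact (Finset.prod_eq_zero (Finset.mem_univ i) (indicator_of_notMem hi _)).symm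
  simp_rw [this]
  rw [lintegral_pi_prod_eq_prod μ fun i => (hf i).indicator (hs i)]
  refine Finset.prod_congr rfl fun i _ => ?_
  rw [lintegral_indicator (hs i), ← withDensity_apply _ (hs i), h i]
  rfl

theorem ae_nonneg_pi_gammaLaw (a : ι → ℝ≥0) :
    ∀ᵐ z ∂(Measure.pi fun i => gammaLaw (a i)), ∀ i, 0 ≤ z i := by
  rw [ae_all_iff]
  exact fun i => (measurePreserving_eval (fun i => gammaLaw (a i)) i).quasiMeasurePreserving.ae
    (ae_nonneg_gammaLaw (a i))

theorem pi_gammaLaw_withDensity_eval [DecidableEq ι] (a : ι → ℝ≥0) (j : ι) :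
    (Measure.pi fun i => gammaLaw (a i)).withDensity (fun z => ENNReal.ofReal (z j)) =
      (a j : ℝ≥0∞) • Measure.pi fun i => gammaLaw ((a + Pi.single j 1 : ι → ℝ≥0) i) := by
  have h := pi_withDensity_prod (fun i => gammaLaw (a i))
    (fun i => gammaLaw ((a + Pi.single j 1 : ι → ℝ≥0) i))
    (f := fun i => if i = j then ENNReal.ofReal else fun _ => 1)
    (fun i => by split_ifs <;> fun_prop) (fun i => if i = j then a j else 1) (fun i => by
      by_cases hij : i = j
      · subst hij
        simpa using gammaLaw_withDensity_ofReal (a i)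
      · have : (fun _ : ℝ => (1 : ℝ≥0∞)) = 1 := rfl
        simp [hij, this])
  convert h using 2
  · ext z
    rw [Finset.prod_eq_single j (fun i _ hij => by simp [hij]) (by simp)]
    simp
  · simp

theorem pi_gammaLaw_withDensity_exp (a : ι → ℝ≥0) {t : ℝ} (ht : t < 1) :
    (Measure.pi fun i => gammaLaw (a i)).withDensity
        (fun z => ENNReal.ofReal (Real.exp (t * ∑ i, z i))) =
      ENNReal.ofReal ((1 - t) ^ (-(∑ i, a i : ℝ))) •
        (Measure.pi fun i => gammaLaw (a i)).map fun z i => (1 - t)⁻¹ * z i := by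
  have hc : 0 < 1 - t := by linarith
  have (i : ι) : IsProbabilityMeasure ((gammaLaw (a i)).map fun x => (1 - t)⁻¹ * x) :=
    Measure.isProbabilityMeasure_map (by fun_prop)
  have h := pi_withDensity_prod (fun i => gammaLaw (a i))
    (fun i => (gammaLaw (a i)).map fun x => (1 - t)⁻¹ * x)
    (f := fun i x => ENNReal.ofReal (Real.exp (t * x)))
    (fun i => by fun_prop) (fun i => Real.toNNReal ((1 - t) ^ (-(a i : ℝ))))
    (fun i => gammaLaw_withDensity_exp (a i) ht)
  rw [Measure.pi_map_pi fun i => by fun_prop]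
  convert h using 2
  · ext z
    rw [← ENNReal.ofReal_prod_of_nonneg fun i _ => (Real.exp_pos _).le, ← Real.exp_sum,
      Finset.mul_sum]
  · rw [← Real.toNNReal_prod_of_nonneg fun i _ => by positivity, ← Finset.sum_neg_distrib,
      Real.rpow_sum_of_pos hc]
    rfl

/-- The proportions of independent Gamma variables do not feel a size-biasing by their sum. -/
theorem setLIntegral_sum_pi_gammaLaw (a : ι → ℝ≥0) {G : Set (ι → ℝ)} (hG : MeasurableSet G) :
    ∫⁻ z in (fun (z : ι → ℝ) i => z i / ∑ j, z j) ⁻¹' G, ENNReal.ofReal (∑ i, z i)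
        ∂(Measure.pi fun i => gammaLaw (a i)) =
      ((∑ i, a i : ℝ≥0) : ℝ≥0∞) * (Measure.pi fun i => gammaLaw (a i))
        ((fun (z : ι → ℝ) i => z i / ∑ j, z j) ⁻¹' G) := by
  set R := Measure.pi fun i => gammaLaw (a i) with hR
  set E := (fun (z : ι → ℝ) i => z i / ∑ j, z j) ⁻¹' G with hE
  have hEm : MeasurableSet E := hG.preimage (by fun_prop)
  set A : ℝ := ∑ i, (a i : ℝ) with hA
  -- Tilting by `exp (t * ∑ z i)` amounts to rescaling `z` by `(1 - t)⁻¹`, and `E` is scale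
  -- invariant. So the tilted mass of `E` is `(1 - t) ^ (-A) * R E`; its derivative at `t = 0` is
  -- the required integral.
  have hexp (t : ℝ) (ht : t < 1) :
      ∫⁻ z, ENNReal.ofReal (Real.exp (t * ∑ i, z i)) ∂(R.restrict E) =
        ENNReal.ofReal ((1 - t) ^ (-A)) * R E := by
    have hc : 0 < 1 - t := by linarith
    rw [← withDensity_apply _ hEm, pi_gammaLaw_withDensity_exp a ht, Measure.smul_apply,
      Measure.map_apply (by fun_prop) hEm, smul_eq_mul]
    congr 2
    ext z
    simp only [hE, mem_preimage, ← Finset.mul_sum]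
    rw [iff_iff_eq]
    congr 1
    ext i
    exact mul_div_mul_left _ _ (inv_ne_zero hc.ne')
  have hint (t : ℝ) (ht : t < 1) :
      Integrable (fun z => Real.exp (t * ∑ i, z i)) (R.restrict E) := by
    refine ⟨by fun_prop, ?_⟩
    rw [hasFiniteIntegral_iff_ofReal (.of_forall fun z => (Real.exp_pos _).le), hexp t ht]
    exact ENNReal.mul_lt_top ENNReal.ofReal_lt_top (measure_lt_top _ _)
  have hset : (0 : ℝ) ∈ interior (integrableExpSet (fun z : ι → ℝ => ∑ i, z i) (R.restrict E)) :=
    mem_interior.2 ⟨Iio 1, fun t ht => hint t ht, isOpen_Iio, mem_Iio.2 one_pos⟩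
  have hmgf (t : ℝ) (ht : t < 1) :
      mgf (fun z : ι → ℝ => ∑ i, z i) (R.restrict E) t = (1 - t) ^ (-A) * R.real E := by
    have hc : 0 < 1 - t := by linarith
    rw [mgf, integral_eq_lintegral_of_nonneg_ae (.of_forall fun z => (Real.exp_pos _).le)
      (by fun_prop), hexp t ht, ENNReal.toReal_mul, ENNReal.toReal_ofReal (by positivity)]
    rfl
  have hderiv : HasDerivAt (fun t : ℝ => (1 - t) ^ (-A) * R.real E) (A * R.real E) 0 := by
    have h1 : HasDerivAt (fun t : ℝ => 1 - t) (-1) 0 := by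
      simpa using (hasDerivAt_id (0 : ℝ)).const_sub 1
    have h2 := (h1.rpow_const (p := -A) (Or.inl (by norm_num))).mul_const (R.real E)
    simpa using h2
  have hmean : ∫ z, ∑ i, z i ∂(R.restrict E) = A * R.real E := by
    rw [← deriv_mgf_zero hset, ← hderiv.deriv]
    refine Filter.EventuallyEq.deriv_eq ?_
    filter_upwards [Iio_mem_nhds (one_pos : (0 : ℝ) < 1)] with t ht using hmgf t ht
  have hnn : ∀ᵐ z ∂(R.restrict E), 0 ≤ ∑ i, z i :=
    ae_restrict_of_ae ((ae_nonneg_pi_gammaLaw a).mono fun z hz => Finset.sum_nonneg fun i _ => hz i)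
  rw [← ofReal_integral_eq_lintegral_ofReal (integrable_of_mem_interior_integrableExpSet hset) hnn,
    hmean, ENNReal.ofReal_mul (by positivity), ofReal_measureReal]
  congr 1
  rw [ENNReal.ofReal, hA, ← NNReal.coe_sum, Real.toNNReal_coe]

end Pi

/-! ### Size-biasing Dirichlet distributions. -/

instance isProbabilityMeasure_dirichletDistribution {d : ℕ} (a : Fin (d + 1) → ℝ≥0) :
    IsProbabilityMeasure (dirichletDistribution a) :=
  Measure.isProbabilityMeasure_map (by fun_prop)

/-- Size-biasing a Dirichlet distribution by a coordinate increases the corresponding parameter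
by one. -/
theorem lintegral_dirichletDistribution_mul {d : ℕ} (a : Fin (d + 1) → ℝ≥0) (j : Fin (d + 1))
    {f : (Fin (d + 1) → ℝ) → ℝ≥0∞} (hf : Measurable f) :
    ((∑ i, a i : ℝ≥0) : ℝ≥0∞) * ∫⁻ z, ENNReal.ofReal (z j) * f z ∂(dirichletDistribution a) =
      a j * ∫⁻ z, f z ∂(dirichletDistribution (a + Pi.single j 1)) := by
  set p : (Fin (d + 1) → ℝ) → (Fin (d + 1) → ℝ) := fun z i => z i / ∑ j, z j with hp
  have hpm : Measurable p := by fun_prop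
  set R := Measure.pi fun i => gammaLaw (a i) with hR
  -- A density equal to the total only multiplies the law of the proportions by a constant, so the
  -- weight `z j / ∑ z` can be traded for `z j`, which raises the shape of one Gamma factor.
  have key : (R.withDensity fun z => ENNReal.ofReal (∑ i, z i)).map p =
      ((∑ i, a i : ℝ≥0) : ℝ≥0∞) • R.map p := by
    ext G hG
    rw [Measure.map_apply hpm hG, withDensity_apply _ (hpm hG), setLIntegral_sum_pi_gammaLaw a hG,
      Measure.smul_apply, Measure.map_apply hpm hG, smul_eq_mul]
  have hz : ∀ᵐ z ∂(R), ENNReal.ofReal (∑ i, z i) * ENNReal.ofReal (p z j) = ENNReal.ofReal (z j) := by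
    filter_upwards [ae_nonneg_pi_gammaLaw a] with z hz
    have hs : 0 ≤ ∑ i, z i := Finset.sum_nonneg fun i _ => hz i
    rw [← ENNReal.ofReal_mul hs]
    congr 1
    rcases hs.eq_or_lt with h | h
    · have := (Finset.sum_eq_zero_iff_of_nonneg fun i _ => hz i).1 h.symm j (Finset.mem_univ j)
      rw [this, ← h, zero_mul]
    · exact mul_div_cancel₀ _ h.ne'
  rw [dirichletDistribution, dirichletDistribution, ← hR, ← hp, ← smul_eq_mul,
    ← lintegral_smul_measure, ← key, lintegral_map (by fun_prop) hpm, lintegral_map hf hpm,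
    ← smul_eq_mul (a j : ℝ≥0∞), ← lintegral_smul_measure, ← pi_gammaLaw_withDensity_eval,
    lintegral_withDensity_eq_lintegral_mul _ (by fun_prop) (by fun_prop),
    lintegral_withDensity_eq_lintegral_mul _ (by fun_prop) (by fun_prop)]
  refine lintegral_congr_ae ?_
  filter_upwards [hz] with z hz
  simp only [Pi.mul_apply]
  rw [← hz, mul_assoc]

theorem ae_mem_Icc_dirichletDistribution {d : ℕ} (a : Fin (d + 1) → ℝ≥0) :
    ∀ᵐ z ∂(dirichletDistribution a), ∀ i, z i ∈ Icc (0 : ℝ) 1 := by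
  rw [dirichletDistribution, ae_map_iff (by fun_prop) (by
    simp only [ofPred_forall]
    exact MeasurableSet.iInter fun i => measurableSet_Icc.preimage (measurable_pi_apply i))]
  filter_upwards [ae_nonneg_pi_gammaLaw a] with z hz i
  have hs : 0 ≤ ∑ i, z i := Finset.sum_nonneg fun i _ => hz i
  exact ⟨div_nonneg (hz i) hs,
    div_le_one_of_le₀ (Finset.single_le_sum (fun i _ => hz i) (Finset.mem_univ i)) hs⟩

/-! ### Determination of measures by moments. -/

/-- Finite measures on a cube are determined by their mixed moments. -/
theorem measure_cube_ext_of_moments {ι : Type*} [Fintype ι] {μ ν : Measure (ι → unitInterval)}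
    [IsFiniteMeasure μ] [IsFiniteMeasure ν]
    (h : ∀ l : List ι, ∫ z, (l.map fun i => (z i : ℝ)).prod ∂μ =
      ∫ z, (l.map fun i => (z i : ℝ)).prod ∂ν) : μ = ν := by
  let e (i : ι) : BoundedContinuousFunction (ι → unitInterval) ℝ :=
    BoundedContinuousFunction.mkOfCompact ⟨fun x => (x i : ℝ), by fun_prop⟩
  let A : StarSubalgebra ℝ (BoundedContinuousFunction (ι → unitInterval) ℝ) :=
    { Algebra.adjoin ℝ (range e) with
      star_mem' := fun {f} hf => by
        have : star f = f := by ext x; simp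
        rwa [this] }
  have hint (ρ : Measure (ι → unitInterval)) [IsFiniteMeasure ρ]
      (f : BoundedContinuousFunction (ι → unitInterval) ℝ) : Integrable f ρ := f.integrable ρ
  -- The coordinates generate a point-separating algebra (Stone–Weierstrass), and by linearity only
  -- monomials, indexed by lists of coordinates, need testing.
  refine ext_of_forall_mem_subalgebra_integral_eq_of_polish (A := A) ?_ ?_
  · intro x y hxy
    obtain ⟨i, hi⟩ := Function.ne_iff.1 hxy
    exact ⟨e i, ⟨BoundedContinuousFunction.toContinuousMapStarₐ ℝ (e i),
      ⟨e i, Algebra.subset_adjoin (mem_range_self i), rfl⟩, rfl⟩, fun h => hi (Subtype.ext h)⟩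
  · intro g hg
    have hg' : g ∈ Submodule.span ℝ (Submonoid.closure (range e) : Set _) := by
      rw [← Algebra.adjoin_eq_span]; exact hg
    clear hg
    induction hg' using Submodule.span_induction with
    | mem f hf =>
      obtain ⟨l, hl, rfl⟩ := Submonoid.exists_list_of_mem_closure hf
      have : ∃ c : List ι, l = c.map e := by
        clear hf
        induction l with
        | nil => exact ⟨[], rfl⟩
        | cons a l ih =>
          obtain ⟨c, hc⟩ := ih fun y hy => hl y (List.mem_cons_of_mem _ hy)
          obtain ⟨i, hi⟩ := hl a List.mem_cons_self
          exact ⟨i :: c, by rw [List.map_cons, hi, hc]⟩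
      obtain ⟨c, rfl⟩ := this
      have hc (x : ι → unitInterval) : (c.map e).prod x = (c.map fun i => (x i : ℝ)).prod := by
        clear hl hf
        induction c with
        | nil => simp
        | cons a l ih =>
          rw [List.map_cons, List.prod_cons, BoundedContinuousFunction.mul_apply, ih]
          simp [e]
      simp_rw [hc]
      exact h c
    | zero => simp
    | add f g _ _ hf hg =>
      simp only [BoundedContinuousFunction.add_apply]
      rw [integral_add (hint _ _) (hint _ _), integral_add (hint _ _) (hint _ _), hf, hg]
    | smul c f _ hf =>
      simp only [BoundedContinuousFunction.smul_apply]
      rw [integral_smul, integral_smul, hf]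

/-- Clamping coordinates to `[0, 1]` is almost surely the identity under both measures, so the
comparison can be carried out on the compact cube. -/
theorem measure_pi_ext_of_moments {ι : Type*} [Fintype ι] {μ ν : Measure (ι → ℝ)}
    [IsFiniteMeasure μ] [IsFiniteMeasure ν]
    (hμ : ∀ᵐ z ∂μ, ∀ i, z i ∈ Icc (0 : ℝ) 1) (hν : ∀ᵐ z ∂ν, ∀ i, z i ∈ Icc (0 : ℝ) 1)
    (h : ∀ l : List ι, ∫⁻ z, (l.map fun i => ENNReal.ofReal (z i)).prod ∂μ =
      ∫⁻ z, (l.map fun i => ENNReal.ofReal (z i)).prod ∂ν) : μ = ν := by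
  let c : (ι → ℝ) → (ι → unitInterval) := fun z i => projIcc 0 1 zero_le_one (z i)
  let d : (ι → unitInterval) → (ι → ℝ) := fun z i => z i
  have hc : Measurable c := (by fun_prop : Continuous c).measurable
  have hd : Measurable d := (by fun_prop : Continuous d).measurable
  have hdc (ρ : Measure (ι → ℝ)) (hρ : ∀ᵐ z ∂ρ, ∀ i, z i ∈ Icc (0 : ℝ) 1) :
      (ρ.map c).map d = ρ := by
    rw [Measure.map_map hd hc]
    conv_rhs => rw [← Measure.map_id (μ := ρ)]
    refine Measure.map_congr ?_
    filter_upwards [hρ] with z hz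
    ext i
    simp [c, d, projIcc_of_mem zero_le_one (hz i)]
  have hmom (ρ : Measure (ι → ℝ)) (hρ : ∀ᵐ z ∂ρ, ∀ i, z i ∈ Icc (0 : ℝ) 1) (l : List ι) :
      ∫ z, (l.map fun i => (z i : ℝ)).prod ∂(ρ.map c) =
        (∫⁻ z, (l.map fun i => ENNReal.ofReal (z i)).prod ∂ρ).toReal := by
    have hm : Measurable fun z : ι → unitInterval => (l.map fun i => (z i : ℝ)).prod := by
      induction l with
      | nil => simp
      | cons a l ih => simp only [List.map_cons, List.prod_cons]; fun_prop
    have hofReal (z : ι → unitInterval) : ENNReal.ofReal (l.map fun i => (z i : ℝ)).prod =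
        (l.map fun i => ENNReal.ofReal (z i : ℝ)).prod := by
      clear hm
      induction l with
      | nil => simp
      | cons a l ih =>
        simp only [List.map_cons, List.prod_cons]
        rw [ENNReal.ofReal_mul (z a).2.1, ih]
    rw [integral_eq_lintegral_of_nonneg_ae (.of_forall fun z => List.prod_nonneg ?_)
      hm.aestronglyMeasurable, lintegral_map (by fun_prop) hc]
    · congr 1
      refine lintegral_congr_ae ?_
      filter_upwards [hρ] with z hz
      rw [hofReal]
      simp only [c, projIcc_of_mem zero_le_one (hz _)]
    · intro x hx
      obtain ⟨i, -, rfl⟩ := List.mem_map.1 hx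
      exact (z i).2.1
  have : μ.map c = ν.map c := measure_cube_ext_of_moments fun l => by
    rw [hmom μ hμ, hmom ν hν, h l]
  rw [← hdc μ hμ, this, hdc ν hν]

/-! ### The Pólya urn and its link with Dirichlet moments. -/

section Urn

variable {S : Type*} [MeasurableSpace S]

theorem measurable_add_dirac :
    Measurable fun p : Measure S × S => p.1 + Measure.dirac p.2 := by
  refine Measure.measurable_of_measurable_coe _ fun s hs => ?_
  simp only [Measure.add_apply]
  exact ((Measure.measurable_coe hs).comp measurable_fst).add
    ((Measure.measurable_coe hs).comp (Measure.measurable_dirac.comp measurable_snd))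

theorem measurable_add_sum_dirac (n : ℕ) :
    Measurable fun p : Measure S × (Fin n → S) => p.1 + ∑ i, Measure.dirac (p.2 i) := by
  refine Measure.measurable_of_measurable_coe _ fun s hs => ?_
  simp only [Measure.add_apply, Measure.finsetSum_apply]
  refine ((Measure.measurable_coe hs).comp measurable_fst).add
    (Finset.measurable_sum _ fun i _ => (Measure.measurable_coe hs).comp
      (Measure.measurable_dirac.comp ((measurable_pi_apply i).comp measurable_snd)))

/-- The law `α / α(S)` of the next draw from an urn with composition `α`; it is zero if `α` is
zero or infinite. -/
noncomputable def urnDraw (S : Type*) [MeasurableSpace S] : Kernel (Measure S) S where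
  toFun α := (α univ)⁻¹ • α
  measurable' := by
    refine Measure.measurable_of_measurable_coe _ fun s hs => ?_
    simp only [Measure.smul_apply, smul_eq_mul]
    exact (Measure.measurable_coe .univ).inv.mul (Measure.measurable_coe hs)

theorem urnDraw_apply (α : Measure S) : urnDraw S α = (α univ)⁻¹ • α := rfl

instance isFiniteKernel_urnDraw : IsFiniteKernel (urnDraw S) :=
  ⟨1, ENNReal.one_lt_top, fun α => by
    rw [urnDraw_apply, Measure.smul_apply, smul_eq_mul]
    exact ENNReal.inv_mul_le_one _⟩

/-- The joint law of the first `n` draws from a Pólya urn with initial composition `α`. -/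
noncomputable def polyaUrn (S : Type*) [MeasurableSpace S] :
    (n : ℕ) → Kernel (Measure S) (Fin n → S)
  | 0 => Kernel.const _ (Measure.dirac Fin.elim0)
  | n + 1 => ((urnDraw S) ⊗ₖ ((polyaUrn S n).comap _ measurable_add_dirac)).map
      fun p => Fin.cons p.1 p.2

theorem measurable_finCons (n : ℕ) :
    Measurable fun p : S × (Fin n → S) => (Fin.cons p.1 p.2 : Fin (n + 1) → S) := by
  refine measurable_pi_lambda _ fun i => ?_
  refine Fin.cases ?_ (fun j => ?_) i
  · simpa using measurable_fst
  · simpa [Function.comp_def] using (measurable_pi_apply j).comp measurable_snd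

instance isFiniteKernel_polyaUrn (n : ℕ) : IsFiniteKernel (polyaUrn S n) := by
  induction n with
  | zero => rw [polyaUrn]; infer_instance
  | succ n ih => rw [polyaUrn]; infer_instance

/-- The probability that successive draws from a Pólya urn with initial composition `α` fall into
the given sets. -/
noncomputable def urnProb : List (Set S) → Measure S → ℝ≥0∞
  | [], _ => 1
  | A :: l, α => ∫⁻ x in A, urnProb l (α + Measure.dirac x) ∂(urnDraw S α)

theorem measurable_urnProb {l : List (Set S)} (hl : ∀ A ∈ l, MeasurableSet A) :
    Measurable (urnProb l) := by
  induction l with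
  | nil => exact measurable_const
  | cons A l ih =>
    have ih' := ih fun B hB => hl B (List.mem_cons_of_mem _ hB)
    exact Measurable.setLIntegral_kernel_prod_right
      (f := fun α x => urnProb l (α + Measure.dirac x)) (ih'.comp measurable_add_dirac)
      (hl A List.mem_cons_self)

theorem setLIntegral_polyaUrn_succ {n : ℕ} (α : Measure S) {B : Fin (n + 1) → Set S}
    (hB : ∀ i, MeasurableSet (B i)) {f : (Fin (n + 1) → S) → ℝ≥0∞} (hf : Measurable f) :
    ∫⁻ x in univ.pi B, f x ∂(polyaUrn S (n + 1) α) =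
      ∫⁻ x in B 0, ∫⁻ y in univ.pi (fun i => B i.succ), f (Fin.cons x y)
        ∂(polyaUrn S n (α + Measure.dirac x)) ∂(urnDraw S α) := by
  have hpi := MeasurableSet.univ_pi hB
  have hpi' := MeasurableSet.univ_pi fun i : Fin n => hB i.succ
  rw [← lintegral_indicator hpi, polyaUrn, Kernel.lintegral_map _ (measurable_finCons n) _
    (hf.indicator hpi), Kernel.lintegral_compProd _ _ _
    (by exact (hf.indicator hpi).comp (measurable_finCons n)), ← lintegral_indicator (hB 0)]
  refine lintegral_congr fun x => ?_
  rw [Kernel.comap_apply]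
  by_cases hx : x ∈ B 0
  · rw [indicator_of_mem hx, ← lintegral_indicator hpi']
    refine lintegral_congr fun y => ?_
    by_cases hy : y ∈ univ.pi fun i : Fin n => B i.succ
    · rw [indicator_of_mem hy, indicator_of_mem]
      exact fun i _ => Fin.cases hx (fun j => hy j trivial) i
    · rw [indicator_of_notMem hy, indicator_of_notMem]
      exact fun h => hy fun i _ => h i.succ trivial
  · rw [indicator_of_notMem hx]
    refine (lintegral_congr fun y => indicator_of_notMem
      (s := univ.pi B) (fun h => hx (h 0 trivial)) f).trans ?_
    simp

/-- Restart property: after drawing `x_1, …, x_n` the urn begins afresh with composition `α + ∑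
δ_{x_i}`. This is the source of the posterior parameter. Induction on the first draw. -/
theorem urnProb_ofFn_append {n : ℕ} {B : Fin n → Set S} (hB : ∀ i, MeasurableSet (B i))
    {l : List (Set S)} (hl : ∀ A ∈ l, MeasurableSet A) (α : Measure S) :
    urnProb (List.ofFn B ++ l) α =
      ∫⁻ x in univ.pi B, urnProb l (α + ∑ i, Measure.dirac (x i)) ∂(polyaUrn S n α) := by
  have hm (n : ℕ) (α : Measure S) :
      Measurable fun x : Fin n → S => urnProb l (α + ∑ i, Measure.dirac (x i)) :=
    (measurable_urnProb hl).comp ((measurable_add_sum_dirac n).comp measurable_prodMk_left)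
  induction n generalizing α with
  | zero =>
    have : univ.pi B = univ := by ext; simp
    rw [this, Measure.restrict_univ, polyaUrn, Kernel.const_apply, lintegral_dirac' _ (hm 0 α)]
    simp
  | succ n ih =>
    rw [setLIntegral_polyaUrn_succ α hB (hm _ α), List.ofFn_succ, List.cons_append, urnProb]
    refine lintegral_congr fun x => ?_
    rw [ih fun i => hB i.succ]
    simp [Fin.sum_univ_succ, add_assoc]

theorem polyaUrn_apply_pi {n : ℕ} {B : Fin n → Set S} (hB : ∀ i, MeasurableSet (B i))
    (α : Measure S) : polyaUrn S n α (univ.pi B) = urnProb (List.ofFn B) α := by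
  have := urnProb_ofFn_append hB (l := []) (by simp) α
  rw [List.append_nil] at this
  simp [this, urnProb]

/-- For sets that are unions of cells of a finite partition, the Pólya urn probabilities are
mixed moments of a Dirichlet distribution. -/
theorem urnProb_preimage {d : ℕ} {π : S → Fin (d + 1)} (hπ : Measurable π)
    (l : List (Set (Fin (d + 1)))) (α : Measure S) [IsFiniteMeasure α] (hα : α ≠ 0) :
    urnProb (l.map fun I => π ⁻¹' I) α =
      ∫⁻ z, (l.map fun I => ∑ i, I.indicator (fun i => ENNReal.ofReal (z i)) i).prod
        ∂(dirichletDistribution fun i => (α (π ⁻¹' {i})).toNNReal) := by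
  induction l generalizing α with
  | nil => simp [urnProb]
  | cons I l ih =>
    set a : Fin (d + 1) → ℝ≥0 := fun i => (α (π ⁻¹' {i})).toNNReal with ha
    set g : (Fin (d + 1) → ℝ) → ℝ≥0∞ := fun z =>
      (l.map fun I => ∑ i, I.indicator (fun i => ENNReal.ofReal (z i)) i).prod with hg
    have hind (I : Set (Fin (d + 1))) (i : Fin (d + 1)) :
        Measurable fun z : Fin (d + 1) → ℝ => I.indicator (fun i => ENNReal.ofReal (z i)) i := by
      by_cases hi : i ∈ I
      · simp only [indicator_of_mem hi]; fun_prop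
      · simp only [indicator_of_notMem hi]; fun_prop
    have hgm : Measurable g := by
      clear ih
      rw [hg]
      induction l with
      | nil => simp
      | cons J l ihl =>
        simp only [List.map_cons, List.prod_cons]
        exact (Finset.measurable_sum _ fun i _ => hind J i).mul (ihl rfl)
    have ha' (i : Fin (d + 1)) : (a i : ℝ≥0∞) = α (π ⁻¹' {i}) :=
      ENNReal.coe_toNNReal (measure_ne_top _ _)
    have hsum : ((∑ i, a i : ℝ≥0) : ℝ≥0∞) = α univ := by
      rw [ENNReal.ofNNReal_finsetSum]
      simp_rw [ha']
      rw [sum_measure_preimage_singleton _ fun i _ => hπ (measurableSet_singleton i)]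
      simp
    -- A draw `x` raises by one the Dirichlet parameter of the cell `π x` only.
    have hstep (x : S) : urnProb (l.map fun I => π ⁻¹' I) (α + Measure.dirac x) =
        ∫⁻ z, g z ∂(dirichletDistribution (a + Pi.single (π x) 1)) := by
      have hne : α + Measure.dirac x ≠ 0 := by
        intro h
        have := congrArg (fun μ : Measure S => μ univ) h
        simp at this
      rw [ih (α + Measure.dirac x) hne]
      congr 2
      ext i
      simp only [Measure.add_apply, Pi.add_apply, ha,
        Measure.dirac_apply' _ (hπ (measurableSet_singleton i))]
      rw [ENNReal.toNNReal_add (measure_ne_top _ _) (by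
        unfold indicator; split_ifs <;> simp)]
      by_cases h : π x = i
      · simp [h]
      · simp [h, Ne.symm h]
    rw [List.map_cons, urnProb]
    simp_rw [hstep, List.map_cons, List.prod_cons, Finset.sum_mul]
    rw [urnDraw_apply, Measure.restrict_smul, lintegral_smul_measure, smul_eq_mul,
      lintegral_finsetSum _ fun i _ => by exact (hind I i).mul hgm]
    -- The integrand depends on `x` only through its cell, so the integral is a finite sum;
    -- size-biasing then matches it term by term.
    have hmap : ∫⁻ x in π ⁻¹' I, ∫⁻ z, g z ∂(dirichletDistribution (a + Pi.single (π x) 1)) ∂α =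
        ∑ i, I.indicator (fun i => ∫⁻ z, g z ∂(dirichletDistribution (a + Pi.single i 1))) i *
          a i := by
      have hI : MeasurableSet I := I.toFinite.measurableSet
      rw [← lintegral_indicator (hπ hI)]
      have := lintegral_map (μ := α) (f := I.indicator fun i =>
        ∫⁻ z, g z ∂(dirichletDistribution (a + Pi.single i 1))) (measurable_of_finite _) hπ
      rw [lintegral_fintype] at this
      simp_rw [Measure.map_apply hπ (measurableSet_singleton _), ← ha'] at this
      rw [this]
      rfl
    rw [hmap, Finset.mul_sum]
    refine Finset.sum_congr rfl fun i _ => ?_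
    by_cases hi : i ∈ I
    · simp only [indicator_of_mem hi]
      have h := lintegral_dirichletDistribution_mul a i hgm
      rw [hsum] at h
      rw [mul_comm _ (a i : ℝ≥0∞), ← h, ← mul_assoc, ENNReal.inv_mul_cancel
        (by simpa using hα) (measure_ne_top _ _), one_mul]
    · simp [indicator_of_notMem hi]

end Urn

/-! ### Dirichlet processes: moment characterisation and uniqueness. -/

section DirichletProcess

variable {S : Type*} [MeasurableSpace S]

theorem measurable_probabilityMeasure_apply {B : Set S} (hB : MeasurableSet B) :
    Measurable fun ν : ProbabilityMeasure S => (ν : Measure S) B :=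
  (Measure.measurable_coe hB).comp measurable_subtype_coe

theorem measurable_probabilityMeasure_real {B : Set S} (hB : MeasurableSet B) :
    Measurable fun ν : ProbabilityMeasure S => (ν : Measure S).real B :=
  (measurable_probabilityMeasure_apply hB).ennreal_toReal

theorem ofReal_probabilityMeasure_real (ν : ProbabilityMeasure S) (B : Set S) :
    ENNReal.ofReal ((ν : Measure S).real B) = (ν : Measure S) B :=
  ENNReal.ofReal_toReal (measure_ne_top _ _)

theorem measurable_list_prod_apply {l : List (Set S)} (hl : ∀ A ∈ l, MeasurableSet A) :
    Measurable fun ν : ProbabilityMeasure S => (l.map fun A => (ν : Measure S) A).prod := by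
  induction l with
  | nil => simp
  | cons A l ih =>
    simp only [List.map_cons, List.prod_cons]
    exact (measurable_probabilityMeasure_apply (hl A List.mem_cons_self)).mul
      (ih fun B hB => hl B (List.mem_cons_of_mem _ hB))

theorem measurable_prod_apply {n : ℕ} {B : Fin n → Set S} (hB : ∀ i, MeasurableSet (B i)) :
    Measurable fun ν : ProbabilityMeasure S => ∏ i, (ν : Measure S) (B i) :=
  Finset.measurable_prod _ fun i _ => measurable_probabilityMeasure_apply (hB i)

theorem measure_preimage_eq_sum (ν : Measure S) {d : ℕ} {π : S → Fin (d + 1)} (hπ : Measurable π)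
    (I : Set (Fin (d + 1))) : ν (π ⁻¹' I) = ∑ i, I.indicator (fun i => ν (π ⁻¹' {i})) i := by
  classical
  have hI : I = (I.toFinite.toFinset : Set _) := by simp
  rw [hI, ← sum_measure_preimage_singleton _ fun i _ => hπ (measurableSet_singleton i)]
  simp only [Finite.coe_toFinset, indicator_apply, ← Finset.sum_filter]
  exact Finset.sum_congr (by ext; simp) fun _ _ => rfl

/-- Finitely many measurable sets are unions of cells of a finite measurable partition. -/
theorem exists_measurable_fin_preimage {κ : Type*} [Finite κ] {A : κ → Set S}
    (hA : ∀ k, MeasurableSet (A k)) :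
    ∃ (d : ℕ) (π : S → Fin (d + 1)) (I : κ → Set (Fin (d + 1))), Measurable π ∧
      ∀ k, A k = π ⁻¹' (I k) := by
  -- The cells are the membership patterns `κ → Prop`; some cells may be empty.
  obtain ⟨m, ⟨e⟩⟩ := Finite.exists_equiv_fin (κ → Prop)
  obtain ⟨d, rfl⟩ : ∃ d, m = d + 1 :=
    Nat.exists_eq_succ_of_ne_zero (Fin.pos (e fun _ => True)).ne'
  refine ⟨d, fun x => e fun k => x ∈ A k, fun k => {i | e.symm i k}, ?_, fun k => by ext; simp⟩
  refine (measurable_of_finite e).comp (measurable_pi_lambda _ fun k => ?_)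
  exact measurableSet_setOfPred.1 (hA k)

theorem IsDirichletProcessLaw.map_eval_preimage {α : Measure S}
    {Q : Measure (ProbabilityMeasure S)} (hQ : IsDirichletProcessLaw α Q) {d : ℕ}
    {π : S → Fin (d + 1)} (hπ : Measurable π) :
    Q.map (fun (ν : ProbabilityMeasure S) i => (ν : Measure S).real (π ⁻¹' {i})) =
      dirichletDistribution fun i => (α (π ⁻¹' {i})).toNNReal := by
  refine hQ.map_eval_eq d _ (fun i => hπ (measurableSet_singleton i)) (fun i j hij => ?_) ?_
  · exact Disjoint.preimage _ (by simpa using hij)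
  · rw [← preimage_iUnion, iUnion_of_singleton, preimage_univ]

/-- The mixed moments of a Dirichlet process are Pólya urn probabilities. -/
theorem IsDirichletProcessLaw.lintegral_list_prod {α : Measure S} [IsFiniteMeasure α] (hα : α ≠ 0)
    {Q : Measure (ProbabilityMeasure S)} (hQ : IsDirichletProcessLaw α Q) {l : List (Set S)}
    (hl : ∀ A ∈ l, MeasurableSet A) :
    ∫⁻ ν, (l.map fun A => (ν : Measure S) A).prod ∂Q = urnProb l α := by
  obtain ⟨d, π, I, hπ, hI⟩ := exists_measurable_fin_preimage (A := l.get)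
    fun k => hl _ (l.get_mem k)
  have hlI : l = (List.ofFn I).map fun J => π ⁻¹' J := by
    conv_lhs => rw [← List.ofFn_get l]
    rw [List.map_ofFn]
    congr 1
    ext1 k
    exact hI k
  generalize List.ofFn I = l' at hlI
  subst hlI
  rw [urnProb_preimage hπ l' α hα, ← hQ.map_eval_preimage hπ, lintegral_map]
  · refine lintegral_congr fun ν => ?_
    rw [List.map_map]
    congr 2
    ext J
    simp only [Function.comp_apply, measure_preimage_eq_sum _ hπ J, ofReal_probabilityMeasure_real]
  · clear hl hI hQ I
    induction l' with
    | nil => simp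
    | cons J l ih =>
      simp only [List.map_cons, List.prod_cons]
      refine (Finset.measurable_sum _ fun i _ => ?_).mul ih
      by_cases hi : i ∈ J
      · simp only [indicator_of_mem hi]; fun_prop
      · simp only [indicator_of_notMem hi]; fun_prop
  · exact measurable_pi_lambda _ fun i =>
      measurable_probabilityMeasure_real (hπ (measurableSet_singleton i))

/-- A law on `M₁(S)` whose mixed moments are Pólya urn probabilities is a Dirichlet process. -/
theorem isDirichletProcessLaw_of_lintegral_list_prod {α : Measure S} [IsFiniteMeasure α]
    (hα : α ≠ 0) {Q : Measure (ProbabilityMeasure S)} [hQ : IsProbabilityMeasure Q]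
    (h : ∀ l : List (Set S), (∀ A ∈ l, MeasurableSet A) →
      ∫⁻ ν, (l.map fun A => (ν : Measure S) A).prod ∂Q = urnProb l α) :
    IsDirichletProcessLaw α Q := by
  refine ⟨hQ, fun d B hB hdisj hun => ?_⟩
  have hex (x : S) : ∃ i, x ∈ B i := mem_iUnion.1 (hun ▸ mem_univ x)
  choose π hπB using hex
  have hpre (i : Fin (d + 1)) : B i = π ⁻¹' {i} := by
    ext x
    refine ⟨fun hx => ?_, fun hx => hx ▸ hπB x⟩
    by_contra hne
    exact disjoint_left.1 (hdisj hne) (hπB x) hx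
  have hπ : Measurable π := measurable_to_countable' fun i => hpre i ▸ hB i
  obtain rfl : B = fun i => π ⁻¹' {i} := funext hpre
  have hev : Measurable fun (ν : ProbabilityMeasure S) i => (ν : Measure S).real (π ⁻¹' {i}) :=
    measurable_pi_lambda _ fun i => measurable_probabilityMeasure_real (hB i)
  have : IsProbabilityMeasure
      (Q.map fun (ν : ProbabilityMeasure S) i => (ν : Measure S).real (π ⁻¹' {i})) :=
    Measure.isProbabilityMeasure_map hev.aemeasurable
  -- Monomials in the cell masses are the mixed moments for lists of cells, hence the urn
  -- probabilities, hence Dirichlet moments.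
  refine measure_pi_ext_of_moments ?_ (ae_mem_Icc_dirichletDistribution _) fun l => ?_
  · rw [ae_map_iff hev.aemeasurable (by
      simp only [ofPred_forall]
      exact MeasurableSet.iInter fun i => measurableSet_Icc.preimage (measurable_pi_apply i))]
    exact .of_forall fun ν i => ⟨measureReal_nonneg, measureReal_le_one⟩
  · have hu := urnProb_preimage hπ (l.map fun i => ({i} : Set (Fin (d + 1)))) α hα
    have hm : Measurable fun z : Fin (d + 1) → ℝ =>
        (l.map fun i => ENNReal.ofReal (z i)).prod := by
      clear hu
      induction l with
      | nil => simp
      | cons i l ih => simp only [List.map_cons, List.prod_cons]; fun_prop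
    rw [lintegral_map hm hev]
    simp only [List.map_map, Function.comp_def] at hu
    have hs (z : Fin (d + 1) → ℝ) (j : Fin (d + 1)) :
        ∑ i, ({j} : Set (Fin (d + 1))).indicator (fun i => ENNReal.ofReal (z i)) i =
          ENNReal.ofReal (z j) := by
      rw [Finset.sum_eq_single j (fun i _ hij => by simp [hij]) (by simp)]
      simp
    simp_rw [hs] at hu
    rw [← hu, ← h _ (by
      intro A hA
      obtain ⟨i, -, rfl⟩ := List.mem_map.1 hA
      exact hB i)]
    simp [List.map_map, Function.comp_def]

/-- Any finite family of measurable sets is refined by a partition, whose masses have a prescribed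
Dirichlet law. Thus all finite-dimensional laws of `ν ↦ (ν B)_B` agree, and these evaluations
generate the σ-algebra of `M₁(S)`. -/
theorem IsDirichletProcessLaw.unique {α : Measure S} {Q Q' : Measure (ProbabilityMeasure S)}
    (hQ : IsDirichletProcessLaw α Q) (hQ' : IsDirichletProcessLaw α Q') : Q = Q' := by
  have := hQ.isProbabilityMeasure
  have := hQ'.isProbabilityMeasure
  let F : ProbabilityMeasure S → ({B : Set S // MeasurableSet B} → ℝ) :=
    fun ν B => (ν : Measure S).real B
  have hF : Measurable F := measurable_pi_lambda _ fun B => measurable_probabilityMeasure_real B.2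
  have hfin (J : Finset {B : Set S // MeasurableSet B}) :
      (Q.map F).map J.restrict = (Q'.map F).map J.restrict := by
    obtain ⟨d, π, I, hπ, hI⟩ := exists_measurable_fin_preimage (κ := J)
      (A := fun B => (B.1 : Set S)) fun k => k.1.2
    let ev : ProbabilityMeasure S → (Fin (d + 1) → ℝ) :=
      fun ν i => (ν : Measure S).real (π ⁻¹' {i})
    let G : (Fin (d + 1) → ℝ) → (J → ℝ) := fun z k => ∑ i, (I k).indicator z i
    have hev : Measurable ev := measurable_pi_lambda _ fun i =>
      measurable_probabilityMeasure_real (hπ (measurableSet_singleton i))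
    have hG : Measurable G := by
      refine measurable_pi_lambda _ fun k => Finset.measurable_sum _ fun i _ => ?_
      by_cases hi : i ∈ I k
      · simp only [indicator_of_mem hi]; fun_prop
      · simp only [indicator_of_notMem hi]; fun_prop
    have hcomp : J.restrict ∘ F = G ∘ ev := by
      ext ν k
      simp only [Function.comp_apply, Finset.restrict, F, G, ev, measureReal_def]
      rw [hI k, measure_preimage_eq_sum _ hπ, ENNReal.toReal_sum]
      · refine Finset.sum_congr rfl fun i _ => ?_
        by_cases hi : i ∈ I k <;> simp [hi]
      · intro i _
        by_cases hi : i ∈ I k <;> simp [hi]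
    rw [Measure.map_map (by fun_prop) hF, Measure.map_map (by fun_prop) hF, hcomp,
      ← Measure.map_map hG hev, ← Measure.map_map hG hev, hQ.map_eval_preimage hπ,
      hQ'.map_eval_preimage hπ]
  have : IsProbabilityMeasure (Q'.map F) := Measure.isProbabilityMeasure_map hF.aemeasurable
  have hmap : Q.map F = Q'.map F :=
    IsProjectiveLimit.unique (P := fun J => (Q'.map F).map J.restrict) hfin fun _ => rfl
  have hle : (inferInstance : MeasurableSpace (ProbabilityMeasure S)) ≤
      MeasurableSpace.comap F inferInstance := by
    let m' : MeasurableSpace (ProbabilityMeasure S) := MeasurableSpace.comap F inferInstance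
    have hF' : Measurable[m'] F := comap_measurable F
    have : Measurable[m'] fun ν : ProbabilityMeasure S => (ν : Measure S) := by
      refine @Measure.measurable_of_measurable_coe _ _ _ m' _ fun B hB => ?_
      have h := ((measurable_pi_apply (⟨B, hB⟩ : {B : Set S // MeasurableSet B})).comp
        hF').ennreal_ofReal
      convert h using 2 with ν
      exact (ofReal_probabilityMeasure_real _ _).symm
    exact this.comap_le
  ext s hs
  obtain ⟨t, ht, rfl⟩ := hle s hs
  rw [← Measure.map_apply hF ht, ← Measure.map_apply hF ht, hmap]

/-- The default value `0` is the only alternative to a genuine law, so equality with a probability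
measure already proves existence. -/
theorem isDirichletProcessLaw_dirichletProcess {α : Measure S} (h : dirichletProcess α ≠ 0) :
    IsDirichletProcessLaw α (dirichletProcess α) := by
  unfold dirichletProcess at h ⊢
  split_ifs at h ⊢ with hex
  · exact hex.choose_spec
  · exact absurd rfl h

theorem IsDirichletProcessLaw.eq_dirichletProcess {α : Measure S}
    {Q : Measure (ProbabilityMeasure S)} (hQ : IsDirichletProcessLaw α Q) :
    dirichletProcess α = Q := by
  have hex : ∃ Q, IsDirichletProcessLaw α Q := ⟨Q, hQ⟩
  rw [dirichletProcess, dif_pos hex]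
  exact hex.choose_spec.unique hQ

end DirichletProcess

/-! ### Boxes, disintegration and iid sampling kernels. -/

theorem measure_pi_fin_ext {S : Type*} [MeasurableSpace S] {n : ℕ} {ρ ρ' : Measure (Fin n → S)}
    [IsFiniteMeasure ρ] (h : ∀ B : Fin n → Set S, (∀ i, MeasurableSet (B i)) →
      ρ (univ.pi B) = ρ' (univ.pi B)) : ρ = ρ' := by
  refine ext_of_generate_finite _ generateFrom_pi.symm isPiSystem_pi ?_ ?_
  · rintro _ ⟨B, hB, rfl⟩
    exact h B fun i => hB i trivial
  · simpa [pi_univ] using h (fun _ => univ) fun _ => .univ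

theorem measure_prod_pi_fin_ext {E S : Type*} [MeasurableSpace E] [MeasurableSpace S] {n : ℕ}
    {ρ ρ' : Measure (E × (Fin n → S))} [IsFiniteMeasure ρ]
    (h : ∀ C, MeasurableSet C → ∀ B : Fin n → Set S, (∀ i, MeasurableSet (B i)) →
      ρ (C ×ˢ univ.pi B) = ρ' (C ×ˢ univ.pi B)) : ρ = ρ' := by
  have happ (σ : Measure (E × (Fin n → S))) {C : Set E} (hC : MeasurableSet C)
      {t : Set (Fin n → S)} (ht : MeasurableSet t) :
      σ (C ×ˢ t) = (σ.restrict (C ×ˢ univ)).map Prod.snd t := by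
    rw [Measure.map_apply measurable_snd ht, Measure.restrict_apply (measurable_snd ht)]
    congr 1
    ext p
    simp [and_comm]
  refine Measure.ext_prod fun {C t} hC ht => ?_
  rw [happ ρ hC ht, happ ρ' hC ht]
  congr 1
  refine measure_pi_fin_ext fun B hB => ?_
  rw [← happ ρ hC (.univ_pi hB), ← happ ρ' hC (.univ_pi hB)]
  exact h C hC B hB

theorem lintegral_condDistrib_map {Ω E F : Type*} [MeasurableSpace Ω] {P : Measure Ω}
    [IsFiniteMeasure P] [MeasurableSpace E] [MeasurableSpace F] [StandardBorelSpace F] [Nonempty F]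
    {X : Ω → F} (hX : Measurable X) {V : Ω → E} (hV : Measurable V) {f : E × F → ℝ≥0∞}
    (hf : Measurable f) :
    ∫⁻ ω, f (V ω, X ω) ∂P = ∫⁻ p, ∫⁻ x, f (p, x) ∂(condDistrib X V P p) ∂(P.map V) := by
  rw [← Measure.lintegral_compProd hf, compProd_map_condDistrib hX.aemeasurable,
    lintegral_map hf (hV.prodMk hX)]

theorem setLIntegral_condDistrib_map {Ω E F : Type*} [MeasurableSpace Ω] {P : Measure Ω}
    [IsFiniteMeasure P] [MeasurableSpace E] [MeasurableSpace F] [StandardBorelSpace F] [Nonempty F]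
    {X : Ω → F} (hX : Measurable X) {V : Ω → E} (hV : Measurable V) {f : E × F → ℝ≥0∞}
    (hf : Measurable f) {C : Set E} (hC : MeasurableSet C) :
    ∫⁻ ω in V ⁻¹' C, f (V ω, X ω) ∂P =
      ∫⁻ p in C, ∫⁻ x, f (p, x) ∂(condDistrib X V P p) ∂(P.map V) := by
  have h := lintegral_condDistrib_map (P := P) hX hV (hf.indicator (hC.prod .univ))
  rw [← lintegral_indicator hC, ← lintegral_indicator (hV hC)]
  convert h using 2
  · ext ω
    by_cases hω : V ω ∈ C
    · rw [indicator_of_mem (show ω ∈ V ⁻¹' C from hω), indicator_of_mem (by simpa using hω)]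
    · rw [indicator_of_notMem (show ω ∉ V ⁻¹' C from hω), indicator_of_notMem (by simpa using hω)]
  · ext p
    by_cases hp : p ∈ C
    · rw [indicator_of_mem hp]
      exact lintegral_congr fun x => (indicator_of_mem (by simpa using hp) _).symm
    · rw [indicator_of_notMem hp]
      refine (lintegral_zero.symm.trans (lintegral_congr fun x => ?_))
      exact (indicator_of_notMem (by simpa using hp) _).symm

/-- The law of `n` independent draws from `ν`, as a kernel. -/
noncomputable def iidKernel (S : Type*) [MeasurableSpace S] (n : ℕ) :
    Kernel (ProbabilityMeasure S) (Fin n → S) where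
  toFun ν := Measure.pi fun _ => (ν : Measure S)
  measurable' := by
    refine Measurable.measure_of_isPiSystem_of_isProbabilityMeasure generateFrom_pi.symm
      isPiSystem_pi ?_
    rintro _ ⟨B, hB, rfl⟩
    simp only [Measure.pi_pi]
    exact measurable_prod_apply fun i => hB i trivial

instance isMarkovKernel_iidKernel {S : Type*} [MeasurableSpace S] (n : ℕ) :
    IsMarkovKernel (iidKernel S n) :=
  ⟨fun ν => inferInstanceAs (IsProbabilityMeasure (Measure.pi fun _ => (ν : Measure S)))⟩

theorem iidKernel_apply_pi {S : Type*} [MeasurableSpace S] {n : ℕ} (ν : ProbabilityMeasure S)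
    (B : Fin n → Set S) : iidKernel S n ν (univ.pi B) = ∏ i, (ν : Measure S) (B i) :=
  Measure.pi_pi _ _

/-! ### The posterior given the parameter and the draws. -/

section Posterior

variable {Ω S : Type*} [MeasurableSpace Ω] {P : Measure Ω} [IsProbabilityMeasure P]
  [MeasurableSpace S] {n : ℕ}
  {lam : Ω → ProbabilityMeasure S} {α : Ω → Measure S} {X : Ω → Fin n → S}

/-- On boxes, `hiid` turns the law of the draws into moments of `λ`, and `hmom` turns these into urn
probabilities. Both hypotheses are integrated over events of `α`, so random and constant parameters
are treated alike. -/
theorem map_prod_eq_compProd_polyaUrn (hα : Measurable α) (hX : Measurable X)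
    (hmom : ∀ C, MeasurableSet C → ∀ l : List (Set S), (∀ A ∈ l, MeasurableSet A) →
      ∫⁻ ω in α ⁻¹' C, (l.map fun A => (lam ω : Measure S) A).prod ∂P =
        ∫⁻ ω in α ⁻¹' C, urnProb l (α ω) ∂P)
    (hiid : ∀ C, MeasurableSet C → ∀ B : Fin n → Set S, (∀ i, MeasurableSet (B i)) →
      ∀ f : ProbabilityMeasure S → ℝ≥0∞, Measurable f →
      ∫⁻ ω in (fun ω => (α ω, X ω)) ⁻¹' (C ×ˢ univ.pi B), f (lam ω) ∂P =
        ∫⁻ ω in α ⁻¹' C, (∏ i, (lam ω : Measure S) (B i)) * f (lam ω) ∂P) :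
    P.map (fun ω => (α ω, X ω)) = P.map α ⊗ₘ polyaUrn S n := by
  have : IsProbabilityMeasure (P.map α) := Measure.isProbabilityMeasure_map hα.aemeasurable
  have : IsProbabilityMeasure (P.map fun ω => (α ω, X ω)) :=
    Measure.isProbabilityMeasure_map (hα.prodMk hX).aemeasurable
  refine measure_prod_pi_fin_ext fun C hC B hB => ?_
  have h := hiid C hC B hB (fun _ => 1) measurable_const
  have h' := hmom C hC (List.ofFn B) (by simpa [List.forall_mem_ofFn_iff] using hB)
  simp only [lintegral_one, Measure.restrict_apply MeasurableSet.univ, univ_inter, mul_one] at h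
  simp only [List.map_ofFn, List.prod_ofFn, Function.comp_apply] at h'
  rw [Measure.map_apply (hα.prodMk hX) (hC.prod (.univ_pi hB)), h, h',
    Measure.compProd_apply_prod hC (.univ_pi hB), setLIntegral_map hC
    (Kernel.measurable_coe _ (.univ_pi hB)) hα]
  simp_rw [polyaUrn_apply_pi hB]

variable [StandardBorelSpace S] [Nonempty S]

/-- The posterior law of a mixture of Dirichlet processes, given the parameter and `n` draws. -/
theorem condDistrib_prod_eq_dirichletProcess
    (hlam : Measurable lam) (hα : Measurable α) (hX : Measurable X)
    (hpos : ∀ᵐ ω ∂P, 0 < α ω univ ∧ α ω univ < ∞)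
    (hmom : ∀ C, MeasurableSet C → ∀ l : List (Set S), (∀ A ∈ l, MeasurableSet A) →
      ∫⁻ ω in α ⁻¹' C, (l.map fun A => (lam ω : Measure S) A).prod ∂P =
        ∫⁻ ω in α ⁻¹' C, urnProb l (α ω) ∂P)
    (hiid : ∀ C, MeasurableSet C → ∀ B : Fin n → Set S, (∀ i, MeasurableSet (B i)) →
      ∀ f : ProbabilityMeasure S → ℝ≥0∞, Measurable f →
      ∫⁻ ω in (fun ω => (α ω, X ω)) ⁻¹' (C ×ˢ univ.pi B), f (lam ω) ∂P =
        ∫⁻ ω in α ⁻¹' C, (∏ i, (lam ω : Measure S) (B i)) * f (lam ω) ∂P) :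
    ∀ᵐ p ∂(P.map fun ω => (α ω, X ω)), condDistrib lam (fun ω => (α ω, X ω)) P p =
      dirichletProcess (p.1 + ∑ i, Measure.dirac (p.2 i)) := by
  set V : Ω → Measure S × (Fin n → S) := fun ω => (α ω, X ω) with hV
  have hVm : Measurable V := hα.prodMk hX
  have hlaw := map_prod_eq_compProd_polyaUrn hα hX hmom hiid
  have : IsProbabilityMeasure (P.map V) := Measure.isProbabilityMeasure_map hVm.aemeasurable
  have : IsProbabilityMeasure (P.map α) := Measure.isProbabilityMeasure_map hα.aemeasurable
  set K := condDistrib lam V P with hK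
  set m : Measure S × (Fin n → S) → Measure S := fun p => p.1 + ∑ i, Measure.dirac (p.2 i) with hm
  have hmm : Measurable m := measurable_add_sum_dirac n
  -- The conditional moments of `λ` given `V` are urn probabilities with the updated composition `m
  -- p`.
  have hboxes (N : ℕ) (A : Fin N → Set S) (hA : ∀ i, MeasurableSet (A i))
      (D : Set (Measure S × (Fin n → S))) (hD : MeasurableSet D) :
      ∫⁻ ω in V ⁻¹' D, ∏ i, (lam ω : Measure S) (A i) ∂P =
        ∫⁻ p in D, urnProb (List.ofFn A) (m p) ∂(P.map V) := by
    have hA' : ∀ s ∈ List.ofFn A, MeasurableSet s := by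
      simpa [List.forall_mem_ofFn_iff] using hA
    have hu : Measurable fun p => urnProb (List.ofFn A) (m p) := (measurable_urnProb hA').comp hmm
    have hf : Measurable fun ω => ∏ i, (lam ω : Measure S) (A i) :=
      (measurable_prod_apply hA).comp hlam
    have hfin : IsFiniteMeasure ((P.withDensity fun ω => ∏ i, (lam ω : Measure S) (A i)).map V) := by
      have : IsFiniteMeasure (P.withDensity fun ω => ∏ i, (lam ω : Measure S) (A i)) := by
        refine isFiniteMeasure_withDensity (ne_of_lt ?_)
        refine (lintegral_mono fun ω => Finset.prod_le_one' fun i _ => prob_le_one).trans_lt ?_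
        simp
      infer_instance
    suffices h : (P.withDensity fun ω => ∏ i, (lam ω : Measure S) (A i)).map V =
        (P.map V).withDensity fun p => urnProb (List.ofFn A) (m p) by
      have := congrArg (fun μ => μ D) h
      simpa only [Measure.map_apply hVm hD, withDensity_apply _ (hVm hD),
        withDensity_apply _ hD] using this
    -- On `C ×ˢ univ.pi B` the left side is the moment for the list `B ++ A`, and the restart
    -- property gives the right side.
    refine measure_prod_pi_fin_ext fun C hC B hB => ?_
    have hCB := hC.prod (MeasurableSet.univ_pi hB)
    have hB' : ∀ s ∈ List.ofFn B ++ List.ofFn A, MeasurableSet s := by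
      intro s hs
      rcases List.mem_append.1 hs with hs | hs
      · obtain ⟨i, rfl⟩ := List.mem_ofFn.1 hs; exact hB i
      · exact hA' s hs
    have h1 := hmom C hC _ hB'
    simp only [List.map_append, List.prod_append, List.map_ofFn, List.prod_ofFn,
      Function.comp_apply] at h1
    rw [Measure.map_apply hVm hCB, withDensity_apply _ (hVm hCB), withDensity_apply _ hCB,
      hiid C hC B hB (fun ν => ∏ i, (ν : Measure S) (A i)) (measurable_prod_apply hA), h1, hlaw,
      Measure.setLIntegral_compProd hu hC (.univ_pi hB),
      setLIntegral_map hC ?_ hα]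
    · exact lintegral_congr fun ω => urnProb_ofFn_append hB hA' (α ω)
    · exact Measurable.setLIntegral_kernel_prod_right
        (f := fun a x => urnProb (List.ofFn A) (m (a, x))) hu (.univ_pi hB)
  -- There are uncountably many lists of sets, so the null set must not depend on them. Equality of
  -- kernels into `Fin N → S` needs only one null set for each `N`.
  have hkernel : ∀ᵐ p ∂(P.map V), ∀ N, (iidKernel S N ∘ₖ K) p =
      ((polyaUrn S N).comap m hmm) p := by
    rw [ae_all_iff]
    intro N
    refine Kernel.ae_eq_of_compProd_eq (measure_prod_pi_fin_ext fun D hD A hA => ?_)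
    rw [Measure.compProd_apply_prod hD (.univ_pi hA), Measure.compProd_apply_prod hD (.univ_pi hA)]
    simp_rw [Kernel.comp_apply' _ _ _ (MeasurableSet.univ_pi hA), iidKernel_apply_pi,
      Kernel.comap_apply, polyaUrn_apply_pi hA]
    rw [← hboxes N A hA D hD]
    exact (setLIntegral_condDistrib_map hlam hVm
      ((measurable_prod_apply hA).comp measurable_snd) hD).symm
  have hposV : ∀ᵐ p ∂(P.map V), 0 < p.1 univ ∧ p.1 univ < ∞ := by
    have hu : Measurable fun p : Measure S × (Fin n → S) => p.1 univ :=
      (Measure.measurable_coe .univ).comp measurable_fst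
    exact (ae_map_iff (p := fun p => 0 < p.1 univ ∧ p.1 univ < ∞) hVm.aemeasurable
      ((measurableSet_lt measurable_const hu).inter (measurableSet_lt hu measurable_const))).2 hpos
  filter_upwards [hkernel, hposV] with p hp hpp
  have : IsFiniteMeasure p.1 := ⟨hpp.2⟩
  have hne : m p ≠ 0 := by
    intro h
    have := congrArg (fun μ : Measure S => μ univ) h
    simp only [hm, Measure.add_apply, Measure.coe_zero, Pi.zero_apply, add_eq_zero] at this
    exact hpp.1.ne' this.1
  have hfin : IsFiniteMeasure (m p) := by
    have : IsFiniteMeasure (∑ i, Measure.dirac (p.2 i)) := inferInstance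
    simp only [hm]; infer_instance
  refine (IsDirichletProcessLaw.eq_dirichletProcess ?_).symm
  refine isDirichletProcessLaw_of_lintegral_list_prod hne fun l hl => ?_
  have hA : ∀ k, MeasurableSet (l.get k) := fun k => hl _ (l.get_mem k)
  have h := congrArg (fun μ => μ (univ.pi l.get)) (hp l.length)
  simp only [Kernel.comp_apply' _ _ _ (MeasurableSet.univ_pi hA), iidKernel_apply_pi,
      Kernel.comap_apply, polyaUrn_apply_pi hA, List.ofFn_get] at h
  rw [← h]
  refine lintegral_congr fun ν => ?_
  conv_lhs => rw [← List.ofFn_get l]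
  rw [List.map_ofFn, List.prod_ofFn]
  rfl

end Posterior

/-! ### Conditional independence as a change of weight. -/

/-- Given `Z`, an event of `Y` may be replaced by its conditional probability when it is tested
against functions of `X` and `Z`. -/
theorem CondIndepGiven.exists_lintegral_eq {Ω E F G : Type*} [MeasurableSpace Ω] [MeasurableSpace E]
    [MeasurableSpace F] [MeasurableSpace G] {P : Measure Ω} [IsProbabilityMeasure P]
    {Y : Ω → E} {X : Ω → F} {Z : Ω → G} (h : CondIndepGiven Y X Z P) (hY : Measurable Y)
    (hX : Measurable X) (hZ : Measurable Z) {D : Set E} (hD : MeasurableSet D) :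
    ∃ g : G → ℝ≥0∞, Measurable g ∧ ∀ φ : F × G → ℝ≥0∞, Measurable φ →
      ∫⁻ ω in Y ⁻¹' D, φ (X ω, Z ω) ∂P = ∫⁻ ω, g (Z ω) * φ (X ω, Z ω) ∂P := by
  have hm : MeasurableSpace.comap Z inferInstance ≤ ‹MeasurableSpace Ω› := hZ.comap_le
  set u : Ω → ℝ := P⟦Y ⁻¹' D | MeasurableSpace.comap Z inferInstance⟧ with hu
  have hum : StronglyMeasurable[MeasurableSpace.comap Z inferInstance] u :=
    stronglyMeasurable_condExp
  have hind {A : Set Ω} (hA : MeasurableSet A) :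
      Integrable (A.indicator fun _ => (1 : ℝ)) P := (integrable_const 1).indicator hA
  have hu0 : 0 ≤ᵐ[P] u := condExp_nonneg (.of_forall fun ω => indicator_nonneg (by simp) ω)
  -- By Doob–Dynkin the conditional probability of `Y ⁻¹' D` factors through `Z`.
  obtain ⟨g, hg, hgu⟩ := (hum.measurable.ennreal_ofReal).exists_eq_measurable_comp
  refine ⟨g, hg, ?_⟩
  have hgZ : Measurable fun ω => g (Z ω) := hg.comp hZ
  have hgu' (ω : Ω) : g (Z ω) = ENNReal.ofReal (u ω) := (congrFun hgu ω).symm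
  have hXZ : Measurable fun ω => (X ω, Z ω) := hX.prodMk hZ
  have key : (P.restrict (Y ⁻¹' D)).map (fun ω => (X ω, Z ω)) =
      (P.withDensity fun ω => g (Z ω)).map fun ω => (X ω, Z ω) := by
    refine Measure.ext_prod fun {B C} hB hC => ?_
    rw [Measure.map_apply hXZ (hB.prod hC), Measure.map_apply hXZ (hB.prod hC),
      Measure.restrict_apply (hXZ (hB.prod hC)), withDensity_apply _ (hXZ (hB.prod hC))]
    have hZC : MeasurableSet[MeasurableSpace.comap Z inferInstance] (Z ⁻¹' C) := ⟨C, hC, rfl⟩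
    have hset : (fun ω => (X ω, Z ω)) ⁻¹' (B ×ˢ C) = X ⁻¹' B ∩ Z ⁻¹' C := rfl
    have hmul : Integrable (u * (X ⁻¹' B).indicator fun _ => (1 : ℝ)) P := by
      refine (integrable_condExp (m := MeasurableSpace.comap Z inferInstance)
        (f := (Y ⁻¹' D).indicator fun _ => (1 : ℝ)) (μ := P)).mul_bdd (c := 1)
        (hind (hX hB)).aestronglyMeasurable (.of_forall fun ω => ?_)
      by_cases hω : ω ∈ X ⁻¹' B <;> simp [hω]
    have h1 : ∫ ω in Z ⁻¹' C, (Y ⁻¹' D ∩ X ⁻¹' B).indicator (fun _ => (1 : ℝ)) ω ∂P =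
        ∫ ω in Z ⁻¹' C, u ω * (X ⁻¹' B).indicator (fun _ => (1 : ℝ)) ω ∂P := by
      rw [← setIntegral_condExp hm (hind ((hY hD).inter (hX hB))) hZC]
      -- The factor `u` is `Z`-measurable, so it can be moved inside the conditional expectation of
      -- the indicator of `X ⁻¹' B`.
      have hpull := condExp_mul_of_stronglyMeasurable_left hum hmul (hind (hX hB))
      have := setIntegral_condExp hm hmul hZC
      simp only [Pi.mul_apply] at this
      rw [← this]
      refine integral_congr_ae (ae_restrict_of_ae ?_)
      filter_upwards [hpull, h D B hD hB] with ω h1 h2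
      rw [h1, h2]
    have hlhs : ∫ ω in Z ⁻¹' C, (Y ⁻¹' D ∩ X ⁻¹' B).indicator (fun _ => (1 : ℝ)) ω ∂P =
        P.real ((fun ω => (X ω, Z ω)) ⁻¹' (B ×ˢ C) ∩ Y ⁻¹' D) := by
      rw [integral_indicator_const _ ((hY hD).inter (hX hB)), smul_eq_mul, mul_one,
        measureReal_restrict_apply ((hY hD).inter (hX hB)), hset]
      congr 1
      ext ω
      simp only [mem_inter_iff]
      tauto
    have hrhs : ENNReal.ofReal (∫ ω in Z ⁻¹' C, u ω * (X ⁻¹' B).indicator (fun _ => (1 : ℝ)) ω ∂P) =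
        ∫⁻ ω in X ⁻¹' B ∩ Z ⁻¹' C, g (Z ω) ∂P := by
      have hmul' : Integrable (fun ω => u ω * (X ⁻¹' B).indicator (fun _ => (1 : ℝ)) ω)
        (P.restrict (Z ⁻¹' C)) := hmul.integrableOn
      rw [ofReal_integral_eq_lintegral_ofReal hmul', ← lintegral_indicator
        ((hX hB).inter (hZ hC)), ← lintegral_indicator (hZ hC)]
      · refine lintegral_congr fun ω => ?_
        by_cases h1 : Z ω ∈ C <;> by_cases h2 : X ω ∈ B <;> simp [indicator, h1, h2, hgu']
      · refine ae_restrict_of_ae (hu0.mono fun ω hω => mul_nonneg hω ?_)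
        exact indicator_nonneg (by simp) ω
    rw [hset, ← hrhs, ← h1, hlhs, ofReal_measureReal, hset]
  intro φ hφ
  have h1 := lintegral_map (μ := P.restrict (Y ⁻¹' D)) hφ hXZ
  rw [key, lintegral_map hφ hXZ, lintegral_withDensity_eq_lintegral_mul _ hgZ
    (g := fun ω => φ (X ω, Z ω)) (hφ.comp hXZ)] at h1
  exact h1.symm

/-! ### The conditional law given an observation of the draws. -/

section Mixture

variable {Ω S T E : Type*} [MeasurableSpace Ω] {P : Measure Ω} [IsProbabilityMeasure P]
  [MeasurableSpace S] [StandardBorelSpace S] [Nonempty S] [MeasurableSpace T]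
  [MeasurableSpace E] [StandardBorelSpace E] [Nonempty E] {n : ℕ}
  {lam : Ω → ProbabilityMeasure S} {α : Ω → Measure S} {X : Ω → Fin n → S} {Y : Ω → T}

/-- The law of a mixture of Dirichlet processes given observations `Y` of `n` draws `X`, where the
parameter and the draws are almost surely functions of `W`. -/
theorem condDistrib_eq_bind_dirichletProcess
    (hlam : Measurable lam) (hα : Measurable α) (hX : Measurable X) (hY : Measurable Y)
    (hpos : ∀ᵐ ω ∂P, 0 < α ω univ ∧ α ω univ < ∞)
    (hmom : ∀ C, MeasurableSet C → ∀ l : List (Set S), (∀ A ∈ l, MeasurableSet A) →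
      ∫⁻ ω in α ⁻¹' C, (l.map fun A => (lam ω : Measure S) A).prod ∂P =
        ∫⁻ ω in α ⁻¹' C, urnProb l (α ω) ∂P)
    (hiid : ∀ C, MeasurableSet C → ∀ B : Fin n → Set S, (∀ i, MeasurableSet (B i)) →
      ∀ f : ProbabilityMeasure S → ℝ≥0∞, Measurable f →
      ∫⁻ ω in (fun ω => (α ω, X ω)) ⁻¹' (C ×ˢ univ.pi B), f (lam ω) ∂P =
        ∫⁻ ω in α ⁻¹' C, (∏ i, (lam ω : Measure S) (B i)) * f (lam ω) ∂P)
    (hci : CondIndepGiven Y (fun ω => (lam ω, α ω)) X P)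
    {W : Ω → E} (hW : Measurable W) {g : E → Measure S × (Fin n → S)} (hg : Measurable g)
    (hgW : ∀ᵐ ω ∂P, g (W ω) = (α ω, X ω)) :
    ∀ᵐ y ∂(P.map Y), condDistrib lam Y P y = (condDistrib W Y P y).bind fun w =>
      dirichletProcess ((g w).1 + ∑ i, Measure.dirac ((g w).2 i)) := by
  set V : Ω → Measure S × (Fin n → S) := fun ω => (α ω, X ω) with hV
  have hVm : Measurable V := hα.prodMk hX
  set K := condDistrib lam V P with hK
  have hpost := condDistrib_prod_eq_dirichletProcess hlam hα hX hpos hmom hiid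
  have hmapg : (P.map W).map g = P.map V := by
    rw [Measure.map_map hg hW]
    exact Measure.map_congr hgW
  -- It suffices to disintegrate the joint law of `(Y, λ)`; the kernel `K` is kept here in place of
  -- `dirichletProcess` because it is measurable.
  have hjoint : P.map (fun ω => (Y ω, lam ω)) =
      P.map Y ⊗ₘ ((K.comap g hg) ∘ₖ condDistrib W Y P) := by
    have : IsProbabilityMeasure (P.map fun ω => (Y ω, lam ω)) :=
      Measure.isProbabilityMeasure_map (hY.prodMk hlam).aemeasurable
    have : IsProbabilityMeasure (P.map Y) := Measure.isProbabilityMeasure_map hY.aemeasurable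
    refine Measure.ext_prod fun {D H} hD hH => ?_
    have hKH : Measurable fun p => K p H := Kernel.measurable_coe _ hH
    have hH1 : Measurable (H.indicator (1 : ProbabilityMeasure S → ℝ≥0∞)) :=
      measurable_one.indicator hH
    rw [Measure.compProd_apply_prod hD hH]
    simp_rw [Kernel.comp_apply' _ _ _ hH, Kernel.comap_apply]
    rw [← setLIntegral_condDistrib_map hW hY (f := fun p => K (g p.2) H)
      (hKH.comp (hg.comp measurable_snd)) hD]
    have hWV : ∫⁻ ω in Y ⁻¹' D, K (g (W ω)) H ∂P = ∫⁻ ω in Y ⁻¹' D, K (V ω) H ∂P :=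
      lintegral_congr_ae (ae_restrict_of_ae (hgW.mono fun ω hω => by simp only [hω, hV]))
    rw [hWV]
    obtain ⟨w, hw, hwφ⟩ := hci.exists_lintegral_eq hY (hlam.prodMk hα) hX hD
    have e1 := hwφ (fun p => H.indicator 1 p.1.1) (hH1.comp (measurable_fst.comp measurable_fst))
    have e2 := hwφ (fun p => K (p.1.2, p.2) H)
      (hKH.comp ((measurable_snd.comp measurable_fst).prodMk measurable_snd))
    -- The weight `w (X ω)` is a function of `V`, so the indicator of `λ ∈ H` may be replaced by `K
    -- (V ω) H`.
    have e3 : ∫⁻ ω, w (X ω) * H.indicator 1 (lam ω) ∂P = ∫⁻ ω, w (X ω) * K (V ω) H ∂P := by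
      have hw2 : Measurable fun p : Measure S × (Fin n → S) => w p.2 := hw.comp measurable_snd
      rw [lintegral_condDistrib_map hlam hVm
        (f := fun p => w p.1.2 * H.indicator 1 p.2)
        ((hw2.comp measurable_fst).mul (hH1.comp measurable_snd)),
        ← lintegral_map (f := fun p => w p.2 * K p H) (hw2.mul hKH) hVm]
      refine lintegral_congr fun p => ?_
      change ∫⁻ x, w p.2 * H.indicator 1 x ∂(K p) = _
      rw [lintegral_const_mul _ hH1, lintegral_indicator_one hH]
    have hleft : P.map (fun ω => (Y ω, lam ω)) (D ×ˢ H) =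
        ∫⁻ ω in Y ⁻¹' D, H.indicator 1 (lam ω) ∂P := by
      rw [Measure.map_apply (hY.prodMk hlam) (hD.prod hH)]
      have : (fun ω => H.indicator (1 : ProbabilityMeasure S → ℝ≥0∞) (lam ω)) =
          (lam ⁻¹' H).indicator 1 := rfl
      rw [this, lintegral_indicator_one (hlam hH), Measure.restrict_apply (hlam hH), inter_comm]
      rfl
    rw [hleft, e1, e3, ← e2]
  -- Averaging the laws of `W` given `Y` returns the law of `W`, whose image under `g` is the law of
  -- `V`; this transfers the null set of `hpost`.
  have hae : ∀ᵐ y ∂(P.map Y), ∀ᵐ w ∂(condDistrib W Y P y),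
      K (g w) = dirichletProcess ((g w).1 + ∑ i, Measure.dirac ((g w).2 i)) := by
    refine Measure.ae_ae_of_ae_comp ?_
    rw [condDistrib_comp_map hY.aemeasurable hW.aemeasurable]
    refine ae_of_ae_map (p := fun q => K q = dirichletProcess (q.1 + ∑ i, Measure.dirac (q.2 i)))
      hg.aemeasurable ?_
    rw [hmapg]
    exact hpost
  filter_upwards [condDistrib_ae_eq_of_measure_eq_compProd Y hlam.aemeasurable hjoint, hae]
    with y hy hy'
  -- Almost everywhere equality with the kernel `K` makes the `bind` legitimate without a proof that
  -- `dirichletProcess` is measurable in its parameter.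
  rw [hy, Kernel.comp_apply, ← Measure.bind_congr_right hy']
  rfl

end Mixture

/-! ### Infinite iid sequences and the final theorem. -/

theorem infinitePi_forall_fin_mem {S : Type*} [MeasurableSpace S] (ν : ProbabilityMeasure S) {n : ℕ}
    {B : Fin n → Set S} (hB : ∀ i, MeasurableSet (B i)) :
    Measure.infinitePi (fun _ : ℕ => (ν : Measure S)) {x | ∀ i : Fin n, x i ∈ B i} =
      ∏ i, (ν : Measure S) (B i) := by
  let t : ℕ → Set S := fun k => if h : k < n then B ⟨k, h⟩ else univ
  have hset : {x : ℕ → S | ∀ i : Fin n, x i ∈ B i} = Set.pi (Finset.range n) t := by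
    ext x
    simp only [mem_ofPred_eq, Set.mem_pi, Finset.coe_range, mem_Iio, t]
    refine ⟨fun h k hk => ?_, fun h i => ?_⟩
    · rw [dif_pos hk]; exact h ⟨k, hk⟩
    · simpa using h i i.2
  rw [hset, Measure.infinitePi_pi _ fun k _ => ?_, Finset.prod_range]
  · exact Finset.prod_congr rfl fun i _ => by simp [t]
  · simp only [t]
    split_ifs
    · exact hB _
    · exact .univ

/-- Given `V` the first `n` draws are iid from `q (V ω)`, so their indicator integrates to the
product of masses. The map `q` allows `V` to be `(λ, α)` or `λ` alone. -/
theorem setLIntegral_iid_draws {Ω S E : Type*} [MeasurableSpace Ω] {P : Measure Ω}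
    [IsProbabilityMeasure P] [MeasurableSpace S] [StandardBorelSpace S] [Nonempty S]
    [MeasurableSpace E] {η : ℕ → Ω → S} (hη : ∀ i, Measurable (η i)) {V : Ω → E}
    (hV : Measurable V) {q : E → ProbabilityMeasure S} (hq : Measurable q)
    (h : ∀ᵐ p ∂(P.map V), condDistrib (fun ω i => η i ω) V P p =
      Measure.infinitePi fun _ : ℕ => (q p : Measure S))
    {C : Set E} (hC : MeasurableSet C) {n : ℕ} {B : Fin n → Set S} (hB : ∀ i, MeasurableSet (B i))
    {f : ProbabilityMeasure S → ℝ≥0∞} (hf : Measurable f) :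
    ∫⁻ ω in V ⁻¹' C ∩ (fun ω (i : Fin n) => η i ω) ⁻¹' (univ.pi B), f (q (V ω)) ∂P =
      ∫⁻ ω in V ⁻¹' C, (∏ i, (q (V ω) : Measure S) (B i)) * f (q (V ω)) ∂P := by
  set Z : Set (ℕ → S) := {x | ∀ i : Fin n, x i ∈ B i} with hZ
  have hZm : MeasurableSet Z := by
    have : Z = ⋂ i : Fin n, (fun x : ℕ → S => x i) ⁻¹' (B i) := by ext; simp [hZ]
    rw [this]
    exact MeasurableSet.iInter fun i => measurable_pi_apply _ (hB i)
  have hηm : Measurable fun ω i => η i ω := measurable_pi_lambda _ hη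
  have hF : Measurable fun p : E × (ℕ → S) => f (q p.1) * Z.indicator 1 p.2 :=
    ((hf.comp hq).comp measurable_fst).mul ((measurable_one.indicator hZm).comp measurable_snd)
  have hset : (fun ω (i : Fin n) => η i ω) ⁻¹' (univ.pi B) = (fun ω i => η i ω) ⁻¹' Z := by
    ext ω; simp [hZ]
  have h1 := setLIntegral_condDistrib_map (P := P) hηm hV hF hC
  rw [hset, inter_comm, ← Measure.restrict_restrict (hηm hZm), ← lintegral_indicator (hηm hZm)]
  have hleft : ∀ ω, ((fun ω i => η i ω) ⁻¹' Z).indicator (fun ω => f (q (V ω))) ω =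
      f (q (V ω)) * Z.indicator 1 (fun i => η i ω) := by
    intro ω
    by_cases hω : (fun i => η i ω) ∈ Z
    · rw [indicator_of_mem (show ω ∈ (fun ω i => η i ω) ⁻¹' Z from hω), indicator_of_mem hω]
      simp
    · rw [indicator_of_notMem (show ω ∉ (fun ω i => η i ω) ⁻¹' Z from hω),
        indicator_of_notMem hω, mul_zero]
  simp_rw [hleft]
  rw [h1, ← setLIntegral_map hC (f := fun p => (∏ i, (q p : Measure S) (B i)) * f (q p))
    (((measurable_prod_apply hB).comp hq).mul (hf.comp hq)) hV]
  refine lintegral_congr_ae (ae_restrict_of_ae ?_)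
  filter_upwards [h] with p hp
  rw [hp]
  change ∫⁻ x, f (q p) * Z.indicator 1 x ∂_ = _
  rw [lintegral_const_mul _ (measurable_one.indicator hZm), lintegral_indicator_one hZm,
    infinitePi_forall_fin_mem _ hB, mul_comm]

theorem theorem2p2
    {Ω S T : Type*} [MeasurableSpace Ω] (P : Measure Ω) [IsProbabilityMeasure P]
    [TopologicalSpace S] [PolishSpace S] [Nonempty S] [MeasurableSpace S] [BorelSpace S]
    [MeasurableSpace T] (n : ℕ)
    -- a random probability measure, a sequence of `S`-valued and a `T`-valued random variable
    (lam : Ω → ProbabilityMeasure S) (hlam : Measurable lam)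
    (η : ℕ → Ω → S) (hη : ∀ i, Measurable (η i))
    (Y : Ω → T) (hY : Measurable Y) :
    -- random parameter `α`, with `κ = α(S)` and `ρ = α / α(S)` almost surely
    (∀ (α : Ω → Measure S) (κ : Ω → Ioi (0 : ℝ)) (ρ : Ω → ProbabilityMeasure S),
      Measurable α → Measurable κ → Measurable ρ →
      (∀ᵐ ω ∂P, 0 < α ω univ ∧ α ω univ < ∞) →
      (∀ᵐ ω ∂P, (κ ω : ℝ) = (α ω univ).toReal) →
      (∀ᵐ ω ∂P, (ρ ω : Measure S) = (α ω univ)⁻¹ • α ω) →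
      -- `λ | α ~ D(α)`
      (∀ᵐ a ∂(P.map α), condDistrib lam α P a = dirichletProcess a) →
      -- `η | λ, α ~ λ^∞`
      (∀ᵐ p ∂(P.map fun ω => (lam ω, α ω)),
        condDistrib (fun ω i => η i ω) (fun ω => (lam ω, α ω)) P p =
          Measure.infinitePi fun _ : ℕ => (p.1 : Measure S)) →
      -- `Y` and `(λ, α)` are conditionally independent given `(η₁, …, ηₙ)`
      CondIndepGiven Y (fun ω => (lam ω, α ω)) (fun ω (i : Fin n) => η i ω) P →
      ∀ᵐ y ∂(P.map Y), condDistrib lam Y P y =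
        (condDistrib (fun ω => (κ ω, ρ ω, fun i : Fin n => η i ω)) Y P y).bind
          fun z : Ioi (0 : ℝ) × ProbabilityMeasure S × (Fin n → S) =>
            dirichletProcess (ENNReal.ofReal (z.1 : ℝ) • (z.2.1 : Measure S)
              + ∑ i, Measure.dirac (z.2.2 i))) ∧
    -- nonrandom parameter `α`
    (∀ α : Measure S, α ≠ 0 → IsFiniteMeasure α →
      P.map lam = dirichletProcess α →
      (∀ᵐ ν ∂(P.map lam), condDistrib (fun ω i => η i ω) lam P ν =
        Measure.infinitePi fun _ : ℕ => (ν : Measure S)) →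
      CondIndepGiven Y lam (fun ω (i : Fin n) => η i ω) P →
      ∀ᵐ y ∂(P.map Y), condDistrib lam Y P y =
        (condDistrib (fun ω (i : Fin n) => η i ω) Y P y).bind
          fun x : Fin n → S => dirichletProcess (α + ∑ i, Measure.dirac (x i))) := by
  set X : Ω → Fin n → S := fun ω i => η i ω
  have hX : Measurable X := measurable_pi_lambda _ fun i => hη i
  constructor
  · intro α κ ρ hα hκ hρ hpos hκα hρα hdir hiid hci
    have hposm : ∀ᵐ a ∂(P.map α), 0 < a univ ∧ a univ < ∞ := by
      have hu : Measurable fun a : Measure S => a univ := Measure.measurable_coe .univ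
      exact (ae_map_iff (p := fun a => 0 < a univ ∧ a univ < ∞) hα.aemeasurable
        ((measurableSet_lt measurable_const hu).inter (measurableSet_lt hu measurable_const))).2 hpos
    have hlα : Measurable fun ω => (lam ω, α ω) := hlam.prodMk hα
    -- The triple `(κ, ρ, X)` lives in a standard Borel space, and `g` rebuilds the parameter as `α
    -- = κ ρ`.
    refine condDistrib_eq_bind_dirichletProcess hlam hα hX hY hpos ?_ ?_ hci
      (W := fun ω => (κ ω, ρ ω, X ω)) (hκ.prodMk (hρ.prodMk hX))
      (g := fun z => (ENNReal.ofReal (z.1 : ℝ) • (z.2.1 : Measure S), z.2.2)) ?_ ?_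
    · intro C hC l hl
      have hm := measurable_list_prod_apply hl
      rw [setLIntegral_condDistrib_map hlam hα
        (f := fun p => (l.map fun A => (p.2 : Measure S) A).prod) (hm.comp measurable_snd) hC,
        ← setLIntegral_map hC (measurable_urnProb hl) hα]
      refine lintegral_congr_ae (ae_restrict_of_ae ?_)
      filter_upwards [hposm, hdir] with a ha hda
      have : IsFiniteMeasure a := ⟨ha.2⟩
      have hne : a ≠ 0 := fun h => by simp [h] at ha
      -- `D(a)` exists because it equals a conditional distribution, which has mass one.
      have hlaw : IsDirichletProcessLaw a (condDistrib lam α P a) := by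
        rw [hda]
        refine isDirichletProcessLaw_dirichletProcess ?_
        rw [← hda]
        exact IsProbabilityMeasure.ne_zero _
      exact hlaw.lintegral_list_prod hne hl
    · intro C hC B hB f hf
      have hset : (fun ω => (α ω, X ω)) ⁻¹' (C ×ˢ univ.pi B) =
          (fun ω => (lam ω, α ω)) ⁻¹' (univ ×ˢ C) ∩ X ⁻¹' (univ.pi B) := by
        ext ω; simp
      have hset' : α ⁻¹' C = (fun ω => (lam ω, α ω)) ⁻¹' (univ ×ˢ C) := by
        ext ω; simp
      rw [hset, hset']
      exact setLIntegral_iid_draws hη hlα measurable_fst hiid (MeasurableSet.univ.prod hC) hB hf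
    · refine Measurable.prodMk (Measure.measurable_of_measurable_coe _ fun s hs => ?_)
        (measurable_snd.comp measurable_snd)
      simp only [Measure.smul_apply, smul_eq_mul]
      exact (measurable_subtype_coe.comp measurable_fst).ennreal_ofReal.mul
        ((measurable_probabilityMeasure_apply hs).comp (measurable_fst.comp measurable_snd))
    · filter_upwards [hpos, hκα, hρα] with ω h1 h2 h3
      simp only [Prod.mk.injEq, and_true]
      rw [h2, h3, ENNReal.ofReal_toReal h1.2.ne, smul_smul, ENNReal.mul_inv_cancel h1.1.ne' h1.2.ne,
        one_smul]
  · intro α hne hfin hdir hiid hci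
    have hlaw : IsDirichletProcessLaw α (P.map lam) := by
      have : IsProbabilityMeasure (P.map lam) := Measure.isProbabilityMeasure_map hlam.aemeasurable
      rw [hdir]
      refine isDirichletProcessLaw_dirichletProcess ?_
      rw [← hdir]
      exact IsProbabilityMeasure.ne_zero _
    -- With `α` constant, an event of `(λ, α)` is an event of `λ` (a section of the set), and each
    -- event `α ∈ C` is either everything or empty.
    refine condDistrib_eq_bind_dirichletProcess (α := fun _ => α) hlam measurable_const hX hY
      (.of_forall fun _ => ⟨by simpa [pos_iff_ne_zero] using hne, measure_lt_top _ _⟩) ?_ ?_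
      (fun A B hA hB => hci A _ hA (measurable_prodMk_right hB)) (W := X) hX
      (g := fun x => (α, x)) measurable_prodMk_left (.of_forall fun _ => rfl)
    · intro C _ l hl
      by_cases hαC : α ∈ C
      · have hset : (fun _ : Ω => α) ⁻¹' C = univ := by ext; simpa using hαC
        rw [hset, Measure.restrict_univ, ← lintegral_map (measurable_list_prod_apply hl) hlam,
          hlaw.lintegral_list_prod hne hl]
        simp
      · have hset : (fun _ : Ω => α) ⁻¹' C = ∅ := by ext; simpa using hαC
        simp [hset]
    · intro C _ B hB f hf
      by_cases hαC : α ∈ C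
      · have hset : (fun ω => (α, X ω)) ⁻¹' (C ×ˢ univ.pi B) =
            lam ⁻¹' univ ∩ X ⁻¹' (univ.pi B) := by
          ext ω; simp [hαC]
        have hset' : (fun _ : Ω => α) ⁻¹' C = lam ⁻¹' univ := by ext; simpa using hαC
        rw [hset, hset']
        exact setLIntegral_iid_draws hη hlam measurable_id hiid .univ hB hf
      · have hset : (fun ω => (α, X ω)) ⁻¹' (C ×ˢ univ.pi B) = ∅ := by ext; simp [hαC]
        have hset' : (fun _ : Ω => α) ⁻¹' C = ∅ := by ext; simpa using hαC
        rw [hset, hset']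
        simp
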